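/- **Setting.** Let $(\Omega,\mathscr A,\mathbb P)$ be a probability space, $(\xi_t)_{t=0,1,\dots}$ a strictly stationary sequence of random Borel probability measures on $\mathbb R$, $\Xi=\sigma(\xi_0,\xi_1,\dots)$, and $(X_\tau)_{\tau\ge 0}$ a real-valued process such that $(\xi_t,X_\tau)$ is a *conjugate process*: $\mathbb P[X_\tau\in B\mid\Xi]=\xi_t(B)$ a.s. for every Borel set $B$, every $t\in\{0,1,\dots\}$ and every $\tau\in[t,t+1)$. Assume that it is *cyclic-independent*: conditionally on $\Xi$, the processes $(X_\tau:\tau\in[t,t+1))$, $t=0,1,\dots$, are independent. Let $\mu$ be a *diffraction* of $(\xi_t)$: a finite Borel measure on $\mathbb R$ equivalent to Lebesgue measure on some interval containing the support of $\mathbb E\xi_0$. Write $\Vert\cdot\Vert$ and $\langle\cdot,\cdot\rangle$ for the norm and inner product of $L^2(\mu)$. Put $F_t(x)=\xi_t(-\infty,x]$ and $C_k(x,y)=\mathrm{Cov}(F_0(x),F_k(y))$. Fix an integer $p\ge1$ and let $R^\mu$ be the integral operator on $L^2(\mu)$ with kernel $$R_\mu(x,y)=\sum_{k=1}^p\int C_k(x,z)C_k(y,z)\,\mu(dz).$$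 In each cycle $t$ the process is observed at finitely many (and at least one) non-random times in $[t,t+1)$, giving observations $X_{1t},\dots,X_{q_t t}$ with $q_t\ge1$; let $\widehat F_t(x)=q_t^{-1}\sum_{i=1}^{q_t}\mathbb I[X_{it}\le x]$, and for $n>p$ let $\widehat{\mathbb E}F_0=n^{-1}\sum_{t=1}^n\widehat F_t$, $$\widehat C_k(x,y)=\frac1{n-p}\sum_{t=1}^{n-p}\big(\widehat F_t(x)-\widehat{\mathbb E}F_0(x)\big)\big(\widehat F_{t+k}(y)-\widehat{\mathbb E}F_0(y)\big),$$ and let $\widehat R^\mu$ be the integral operator on $L^2(\mu)$ with kernel $\sum_{k=1}^p\int\widehat C_k(x,z)\widehat C_k(y,z)\,\mu(dz)$. Let $\theta_1\ge\theta_2\ge\cdots\ge0$ and $\widehat\theta_1\ge\widehat\theta_2\ge\cdots\ge0$ be the non-increasing sequences of eigenvalues of $R^\mu$ and $\widehat R^\mu$: every positive eigenvalue is repeated according to its multiplicity, and the sequence is completed by zeros if there are only finitely many positive eigenvalues. Let $\Vert\cdot\Vert_{HS}$ be the Hilbert–Schmidt norm, that is, the $L^2(\mu\otimes\mu)$ norm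 of the kernel. **Theorem.** Assume that $(\widehat F_t)_{t\ge1}$ is $\psi$-mixing, that is, $\Psi(k)\to0$ where $$\Psi(k)=\sup_{j\ge1}\ \sup\Big\{\Big|\frac{\mathbb P(A\cap B)}{\mathbb P(A)\mathbb P(B)}-1\Big| : A\in\sigma(\widehat F_1,\dots,\widehat F_j),\ B\in\sigma(\widehat F_{j+k},\widehat F_{j+k+1},\dots),\ \mathbb P(A)\mathbb P(B)>0\Big\},$$ and that $\sum_{k=1}^\infty k\,\Psi(k)^{1/2}<\infty$. Then, as $n\to\infty$, 1. $\Vert\widehat R^\mu-R^\mu\Vert_{HS}=O_{\mathbb P}(n^{-1/2})$; 2. $\sup_{j\ge1}|\widehat\theta_j-\theta_j|=O_{\mathbb P}(n^{-1/2})$. Suppose moreover that the nonzero eigenvalues of $R^\mu$ are all distinct (each has multiplicity one), and let $(\psi_j)_{j\ge1}$ and $(\widehat\psi_j)_{j\ge1}$ be orthonormal sequences in $L^2(\mu)$ with $R^\mu\psi_j=\theta_j\psi_j$ and $\widehat R^\mu\widehat\psi_j=\widehat\theta_j\widehat\psi_j$ for all $j$. Then 3. for each $j$ with $\theta_j>0$,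 if the sign of $\widehat\psi_j$ is chosen so that $\langle\widehat\psi_j,\psi_j\rangle\ge0$, then $\Vert\widehat\psi_j-\psi_j\Vert=O_{\mathbb P}(n^{-1/2})$. -/

import Mathlib

open MeasureTheory ProbabilityTheory Filter Topology
open scoped NNReal ENNReal

namespace ConjugateProcess

noncomputable section

/-! ### Integral operators on `L²(μ)` and their eigenvalues -/

/-- A kernel in `L²(μ ⊗ μ)` has almost all of its sections in `L²(μ)`. -/
theorem memLp_section {μ : Measure ℝ} [IsFiniteMeasure μ] {K : ℝ → ℝ → ℝ}
    (hK : MemLp (Function.uncurry K) 2 (μ.prod μ)) :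
    ∀ᵐ x ∂μ, MemLp (K x) 2 μ := by
  filter_upwards [hK.1.prodMk_left, hK.integrable_sq.prod_right_ae] with x hx1 hx2
  exact (memLp_two_iff_integrable_sq hx1).2 hx2

/-- If `K ∈ L²(μ ⊗ μ)` and `f ∈ L²(μ)`, then `x ↦ ∫ K(x,y) f(y) μ(dy)` is in `L²(μ)`. -/
theorem memLp_integral_kernel {μ : Measure ℝ} [IsFiniteMeasure μ] {K : ℝ → ℝ → ℝ}
    (hK : MemLp (Function.uncurry K) 2 (μ.prod μ)) (f : Lp ℝ 2 μ) :
    MemLp (fun x => ∫ y, K x y * f y ∂μ) 2 μ := by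
  have hmeas : AEStronglyMeasurable (fun x => ∫ y, K x y * f y ∂μ) μ := by
    have h : AEStronglyMeasurable (fun z : ℝ × ℝ => K z.1 z.2 * f z.2) (μ.prod μ) :=
      hK.1.mul (Lp.aestronglyMeasurable f).comp_snd
    exact h.integral_prod_right'
  rw [memLp_two_iff_integrable_sq hmeas]
  have hdom : Integrable (fun x => (∫ y, K x y ^ 2 ∂μ) * ‖f‖ ^ 2) μ :=
    (hK.integrable_sq.integral_prod_left).mul_const _
  refine hdom.mono' (hmeas.pow 2) ?_
  filter_upwards [memLp_section hK] with x hx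
  have h1 : ∫ y, K x y * f y ∂μ = inner ℝ (hx.toLp (K x)) f := by
    rw [L2.inner_def]
    refine integral_congr_ae ?_
    filter_upwards [hx.coeFn_toLp] with y hy
    simp [hy, mul_comm]
  have h2 : ∫ y, K x y ^ 2 ∂μ = ‖hx.toLp (K x)‖ ^ 2 := by
    rw [← real_inner_self_eq_norm_sq, L2.inner_def]
    refine integral_congr_ae ?_
    filter_upwards [hx.coeFn_toLp] with y hy
    simp [hy, pow_two]
  rw [h1, h2, Real.norm_eq_abs, abs_pow, ← mul_pow]
  exact pow_le_pow_left₀ (abs_nonneg _) (abs_real_inner_le_norm _ _) 2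

open Classical in
/-- The integral operator `f ↦ (x ↦ ∫ K(x,y) f(y) μ(dy))` acting on `L²(μ)`, for a kernel
`K ∈ L²(μ ⊗ μ)` (and, by convention, `0` for any other `K`). -/
def integralOperator (μ : Measure ℝ) [IsFiniteMeasure μ] (K : ℝ → ℝ → ℝ) :
    Module.End ℝ (Lp ℝ 2 μ) :=
  if hK : MemLp (Function.uncurry K) 2 (μ.prod μ) then
    { toFun := fun f => (memLp_integral_kernel hK f).toLp (fun x => ∫ y, K x y * f y ∂μ)
      map_add' := fun f g => by
        rw [← MemLp.toLp_add]
        refine MemLp.toLp_congr _ _ ?_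
        filter_upwards [memLp_section hK] with x hx
        have h : ∀ᵐ y ∂μ, K x y * (f + g : Lp ℝ 2 μ) y = K x y * f y + K x y * g y := by
          filter_upwards [Lp.coeFn_add f g] with y hy
          rw [hy, Pi.add_apply, mul_add]
        rw [integral_congr_ae h, Pi.add_apply]
        exact integral_add (hx.integrable_mul (Lp.memLp f)) (hx.integrable_mul (Lp.memLp g))
      map_smul' := fun c f => by
        rw [RingHom.id_apply, ← MemLp.toLp_const_smul]
        refine MemLp.toLp_congr _ _ (Eventually.of_forall fun x => ?_)
        have h : ∀ᵐ y ∂μ, K x y * (c • f : Lp ℝ 2 μ) y = c * (K x y * f y) := by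
          filter_upwards [Lp.coeFn_smul c f] with y hy
          rw [hy, Pi.smul_apply, smul_eq_mul]
          ring
        simp only [Pi.smul_apply, smul_eq_mul]
        rw [integral_congr_ae h, integral_const_mul] }
  else 0

/-- The Hilbert–Schmidt norm of the integral operator with kernel `K`: the `L²(μ ⊗ μ)` norm of
the kernel. -/
def hsNorm (μ : Measure ℝ) (K : ℝ → ℝ → ℝ) : ℝ≥0∞ :=
  eLpNorm (Function.uncurry K) 2 (μ.prod μ)

/-- `θ 0 ≥ θ 1 ≥ …` is the non-increasing sequence of eigenvalues of the (positive, compact)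
operator `T`: every eigenvalue `c > 0` is listed as often as its multiplicity (the dimension of its
eigenspace), every number `c > 0` that is not an eigenvalue is not listed, and the sequence is
completed by zeros when there are only finitely many positive eigenvalues. -/
structure IsEigenvalueSeq {E : Type*} [AddCommGroup E] [Module ℝ E]
    (T : Module.End ℝ E) (θ : ℕ → ℝ) : Prop where
  antitone : Antitone θ
  nonneg : ∀ j, 0 ≤ θ j
  multiplicity : ∀ c : ℝ, 0 < c → {j | θ j = c}.encard = Module.finrank ℝ (T.eigenspace c)

/-- `ψ 0, ψ 1, …` are orthonormal eigenvectors of `T` that belong to `θ 0, θ 1, …`. -/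
structure IsEigenbasisSeq {E : Type*} [NormedAddCommGroup E] [InnerProductSpace ℝ E]
    (T : Module.End ℝ E) (θ : ℕ → ℝ) (ψ : ℕ → E) : Prop where
  orthonormal : Orthonormal ℝ ψ
  apply_eq : ∀ j, T (ψ j) = θ j • ψ j

/-! ### Stochastic boundedness and `ψ`-mixing -/

/-- `Z n = O_P(a n)` for random variables `Z n ≥ 0`. -/
def IsBigOP {Ω : Type*} [MeasurableSpace Ω] (P : Measure Ω) (Z : ℕ → Ω → ℝ≥0∞) (a : ℕ → ℝ) :
    Prop :=
  ∀ ε : ℝ≥0∞, 0 < ε → ∃ M : ℝ≥0, ∀ᶠ n in atTop, P {ω | M * ENNReal.ofReal (a n) < Z n ω} ≤ ε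

/-- The `ψ`-dependence coefficient of two σ-fields,
`sup |P(A ∩ B) / (P(A) P(B)) - 1|` over `A ∈ 𝒜`, `B ∈ ℬ` of positive probability. -/
def psiCoeff {Ω : Type*} [MeasurableSpace Ω] (P : Measure Ω) (𝒜 ℬ : MeasurableSpace Ω) : ℝ≥0∞ :=
  ⨆ (A : Set Ω) (B : Set Ω) (_ : MeasurableSet[𝒜] A) (_ : MeasurableSet[ℬ] B)
    (_ : P A ≠ 0) (_ : P B ≠ 0),
    ENNReal.ofReal |P.real (A ∩ B) / (P.real A * P.real B) - 1|

/-- The `ψ`-mixing coefficients of a sequence `Y 0, Y 1, …` of random elements: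
`Ψ(k) = sup_j ψ(σ(Y 0, …, Y j), σ(Y (j+k), Y (j+k+1), …))`. -/
def psiMixingCoeff {Ω E : Type*} [MeasurableSpace Ω] [mE : MeasurableSpace E] (P : Measure Ω)
    (Y : ℕ → Ω → E) (k : ℕ) : ℝ≥0∞ :=
  ⨆ j : ℕ, psiCoeff P (⨆ (t : ℕ) (_ : t ≤ j), mE.comap (Y t))
    (⨆ (t : ℕ) (_ : j + k ≤ t), mE.comap (Y t))

/-! ### Conjugate processes

The type `ProbabilityMeasure ℝ` carries the σ-field generated by the maps `ν ↦ ν B`, which is the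
Borel σ-field of the weak topology. -/

section Model

variable {Ω : Type*} [mΩ : MeasurableSpace Ω]

/-- The σ-field `Ξ` generated by the latent process. -/
@[reducible] def latentSigma (ξ : ℕ → Ω → ProbabilityMeasure ℝ) : MeasurableSpace Ω :=
  ⨆ t, MeasurableSpace.comap (ξ t) inferInstance

/-- The `t`-th cycle `[t, t+1)`. -/
def cycle (t : ℕ) : Set ℝ≥0 := Set.Ico (t : ℝ≥0) (t + 1)

/-- `(ξ_t, X_τ)` is a conjugate process: `P(X_τ ∈ B | Ξ) = ξ_t(B)` for `τ` in the `t`-th cycle. -/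
structure IsConjugateProcess (P : Measure Ω) (ξ : ℕ → Ω → ProbabilityMeasure ℝ)
    (X : ℝ≥0 → Ω → ℝ) : Prop where
  measurable_latent : ∀ t, Measurable (ξ t)
  measurable_observable : ∀ τ, Measurable (X τ)
  compatible : ∀ t, ∀ τ ∈ cycle t, ∀ B : Set ℝ, MeasurableSet B →
    P⟦X τ ⁻¹' B | latentSigma ξ⟧ =ᵐ[P] fun ω => (ξ t ω : Measure ℝ).real B

/-- Strict stationarity of the latent process. -/
def IsStationary (P : Measure Ω) (ξ : ℕ → Ω → ProbabilityMeasure ℝ) : Prop :=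
  ∀ h : ℕ, IdentDistrib (fun ω t => ξ (t + h) ω) (fun ω t => ξ t ω) P P

/-- The σ-field generated by `(X_τ : τ ∈ [t, t+1))`. -/
@[reducible] def cycleSigma (X : ℝ≥0 → Ω → ℝ) (t : ℕ) : MeasurableSpace Ω :=
  ⨆ τ ∈ cycle t, MeasurableSpace.comap (X τ) inferInstance

/-- Cyclic independence: conditionally on `Ξ`, the processes `(X_τ : τ ∈ [t, t+1))`,
`t = 0, 1, …`, are independent. -/
def IsCyclicIndependent (P : Measure Ω) (ξ : ℕ → Ω → ProbabilityMeasure ℝ)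
    (X : ℝ≥0 → Ω → ℝ) : Prop :=
  ∀ (s : Finset ℕ) (A : ℕ → Set Ω), (∀ t ∈ s, MeasurableSet[cycleSigma X t] (A t)) →
    P⟦⋂ t ∈ s, A t | latentSigma ξ⟧ =ᵐ[P] fun ω => ∏ t ∈ s, (P⟦A t | latentSigma ξ⟧) ω

/-- The expectation (barycenter) `E ξ_0` of the random measure `ξ_0`. -/
def barycenter (P : Measure Ω) (ξ : ℕ → Ω → ProbabilityMeasure ℝ) : Measure ℝ :=
  P.bind fun ω => (ξ 0 ω : Measure ℝ)

/-- `μ` is a diffraction of `(ξ_t)`: it is equivalent to Lebesgue measure on some interval that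
contains the support of `E ξ_0`. -/
def IsDiffraction (P : Measure Ω) (ξ : ℕ → Ω → ProbabilityMeasure ℝ) (μ : Measure ℝ) : Prop :=
  ∃ I : Set ℝ, I.OrdConnected ∧ (barycenter P ξ).support ⊆ I ∧
    μ ≪ volume.restrict I ∧ volume.restrict I ≪ μ

/-- The latent distribution functions `F_t(x) = ξ_t(-∞, x]`. -/
def latentCdf (ξ : ℕ → Ω → ProbabilityMeasure ℝ) (t : ℕ) (ω : Ω) (x : ℝ) : ℝ :=
  (ξ t ω : Measure ℝ).real (Set.Iic x)

/-- The lagged autocovariance function `C_k(x,y) = Cov(F_0(x), F_k(y))`. -/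
def autocov (P : Measure Ω) (ξ : ℕ → Ω → ProbabilityMeasure ℝ) (k : ℕ) (x y : ℝ) : ℝ :=
  covariance (fun ω => latentCdf ξ 0 ω x) (fun ω => latentCdf ξ k ω y) P

/-- The kernel `R_μ(x,y) = ∑_{k=1}^p ∫ C_k(x,z) C_k(y,z) μ(dz)` of the operator `R^μ`. -/
def kernelR (P : Measure Ω) (ξ : ℕ → Ω → ProbabilityMeasure ℝ) (μ : Measure ℝ) (p : ℕ)
    (x y : ℝ) : ℝ :=
  ∑ k ∈ Finset.Icc 1 p, ∫ z, autocov P ξ k x z * autocov P ξ k y z ∂μ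

end Model

/-! ### Sampling and estimators -/

/-- A sampling scheme: in cycle `t` the process is observed at the times `time t i`, `i < q t`. -/
structure SamplingScheme where
  q : ℕ → ℕ
  q_pos : ∀ t, 0 < q t
  time : ℕ → ℕ → ℝ≥0
  time_mem : ∀ t i, i < q t → time t i ∈ cycle t

section Estimators

variable {Ω : Type*}

/-- The empirical distribution function of the observations of cycle `t`. -/
def empCdf (X : ℝ≥0 → Ω → ℝ) (S : SamplingScheme) (t : ℕ) (ω : Ω) (x : ℝ) : ℝ :=
  (S.q t : ℝ)⁻¹ * ∑ i ∈ Finset.range (S.q t),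
    (Set.Iic x).indicator (fun _ => (1 : ℝ)) (X (S.time t i) ω)

/-- The estimated mean function, `n⁻¹ ∑_{t=1}^n` of the empirical distribution functions. -/
def empMean (X : ℝ≥0 → Ω → ℝ) (S : SamplingScheme) (n : ℕ) (ω : Ω) (x : ℝ) : ℝ :=
  (n : ℝ)⁻¹ * ∑ t ∈ Finset.Icc 1 n, empCdf X S t ω x

/-- The estimated lagged autocovariance function. -/
def empAutocov (X : ℝ≥0 → Ω → ℝ) (S : SamplingScheme) (p n k : ℕ) (ω : Ω) (x y : ℝ) : ℝ :=
  ((n : ℝ) - p)⁻¹ * ∑ t ∈ Finset.Icc 1 (n - p),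
    (empCdf X S t ω x - empMean X S n ω x) * (empCdf X S (t + k) ω y - empMean X S n ω y)

/-- The kernel of the estimator of `R^μ` from the first `n` cycles. -/
def empKernelR (X : ℝ≥0 → Ω → ℝ) (S : SamplingScheme) (μ : Measure ℝ) (p n : ℕ) (ω : Ω)
    (x y : ℝ) : ℝ :=
  ∑ k ∈ Finset.Icc 1 p, ∫ z, empAutocov X S p n k ω x z * empAutocov X S p n k ω y z ∂μ

end Estimators

/-! ### Both kernels are in `L²(μ ⊗ μ)`, so that `integralOperator` is the integral operator -/

theorem memLp_sum_integral_mul (μ : Measure ℝ) [IsFiniteMeasure μ] (p : ℕ)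
    (C : ℕ → ℝ → ℝ → ℝ) (hC : ∀ k, Measurable (Function.uncurry (C k)))
    (hb : ∀ k, ∃ b, ∀ x y, |C k x y| ≤ b) :
    MemLp (Function.uncurry fun x y => ∑ k ∈ Finset.Icc 1 p, ∫ z, C k x z * C k y z ∂μ) 2
      (μ.prod μ) := by
  have h : (Function.uncurry fun x y => ∑ k ∈ Finset.Icc 1 p, ∫ z, C k x z * C k y z ∂μ)
      = fun w : ℝ × ℝ => ∑ k ∈ Finset.Icc 1 p, ∫ z, C k w.1 z * C k w.2 z ∂μ := rfl
  rw [h]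
  refine memLp_finsetSum _ fun k _ => ?_
  obtain ⟨b, hb⟩ := hb k
  have hm : Measurable fun v : (ℝ × ℝ) × ℝ => C k v.1.1 v.2 * C k v.1.2 v.2 :=
    ((hC k).comp ((measurable_fst.comp measurable_fst).prodMk measurable_snd)).mul
      ((hC k).comp ((measurable_snd.comp measurable_fst).prodMk measurable_snd))
  refine MemLp.of_bound hm.stronglyMeasurable.integral_prod_right'.aestronglyMeasurable
    (b * b * μ.real Set.univ) (Eventually.of_forall fun w => ?_)
  refine norm_integral_le_of_norm_le_const (Eventually.of_forall fun z => ?_)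
  rw [norm_mul]
  exact mul_le_mul (hb _ _) (hb _ _) (norm_nonneg _) ((abs_nonneg _).trans (hb w.1 z))

theorem measurable_latentCdf {Ω : Type*} [MeasurableSpace Ω]
    {ξ : ℕ → Ω → ProbabilityMeasure ℝ} (hξ : ∀ t, Measurable (ξ t)) (t : ℕ) :
    Measurable fun w : Ω × ℝ => latentCdf ξ t w.1 w.2 := by
  let κ : Kernel (Ω × ℝ) ℝ :=
    ⟨fun w => (ξ t w.1 : Measure ℝ), measurable_subtype_coe.comp ((hξ t).comp measurable_fst)⟩
  have : IsMarkovKernel κ :=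
    ⟨fun w => inferInstanceAs (IsProbabilityMeasure (ξ t w.1 : Measure ℝ))⟩
  have hs : MeasurableSet {v : (Ω × ℝ) × ℝ | v.2 ≤ v.1.2} :=
    measurableSet_le measurable_snd (measurable_snd.comp measurable_fst)
  exact (Kernel.measurable_kernel_prodMk_left (κ := κ) hs).ennreal_toReal

theorem latentCdf_mem {Ω : Type*} (ξ : ℕ → Ω → ProbabilityMeasure ℝ) (t : ℕ) (ω : Ω) (x : ℝ) :
    latentCdf ξ t ω x ∈ Set.Icc (0 : ℝ) 1 :=
  ⟨measureReal_nonneg, measureReal_le_one⟩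

theorem abs_sub_integral_latentCdf {Ω : Type*} [MeasurableSpace Ω] (P : Measure Ω)
    [IsProbabilityMeasure P] (ξ : ℕ → Ω → ProbabilityMeasure ℝ) (t : ℕ) (ω : Ω) (x : ℝ) :
    |latentCdf ξ t ω x - ∫ ω', latentCdf ξ t ω' x ∂P| ≤ 1 := by
  have h0 : 0 ≤ ∫ ω', latentCdf ξ t ω' x ∂P :=
    integral_nonneg fun ω' => (latentCdf_mem ξ t ω' x).1
  have h1 : ‖∫ ω', latentCdf ξ t ω' x ∂P‖ ≤ 1 * P.real Set.univ :=
    norm_integral_le_of_norm_le_const (Eventually.of_forall fun ω' => by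
      rw [Real.norm_eq_abs, abs_of_nonneg (latentCdf_mem ξ t ω' x).1]
      exact (latentCdf_mem ξ t ω' x).2)
  rw [probReal_univ, mul_one, Real.norm_eq_abs, abs_of_nonneg h0] at h1
  have h2 := latentCdf_mem ξ t ω x
  rw [abs_le]
  constructor <;> linarith [h2.1, h2.2]

theorem memLp_kernelR {Ω : Type*} [MeasurableSpace Ω] (P : Measure Ω) [IsProbabilityMeasure P]
    {ξ : ℕ → Ω → ProbabilityMeasure ℝ} (hξ : ∀ t, Measurable (ξ t)) (μ : Measure ℝ)
    [IsFiniteMeasure μ] (p : ℕ) :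
    MemLp (Function.uncurry (kernelR P ξ μ p)) 2 (μ.prod μ) := by
  refine memLp_sum_integral_mul μ p (autocov P ξ) (fun k => ?_) (fun k => ⟨1, fun x y => ?_⟩)
  · have hm : ∀ t, Measurable fun x : ℝ => ∫ ω, latentCdf ξ t ω x ∂P := fun t =>
      (((measurable_latentCdf hξ t).comp measurable_swap).stronglyMeasurable.integral_prod_right'
        (ν := P)).measurable
    have hF : ∀ t, Measurable fun v : ℝ × Ω => latentCdf ξ t v.2 v.1 := fun t =>
      (measurable_latentCdf hξ t).comp measurable_swap
    have h : Measurable fun v : (ℝ × ℝ) × Ω =>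
        (latentCdf ξ 0 v.2 v.1.1 - ∫ ω, latentCdf ξ 0 ω v.1.1 ∂P) *
          (latentCdf ξ k v.2 v.1.2 - ∫ ω, latentCdf ξ k ω v.1.2 ∂P) := by
      refine Measurable.mul (Measurable.sub ?_ ?_) (Measurable.sub ?_ ?_)
      · exact (hF 0).comp ((measurable_fst.comp measurable_fst).prodMk measurable_snd)
      · exact (hm 0).comp (measurable_fst.comp measurable_fst)
      · exact (hF k).comp ((measurable_snd.comp measurable_fst).prodMk measurable_snd)
      · exact (hm k).comp (measurable_snd.comp measurable_fst)
    exact (h.stronglyMeasurable.integral_prod_right' (ν := P)).measurable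
  · have h : ‖autocov P ξ k x y‖ ≤ 1 * P.real Set.univ := by
      refine norm_integral_le_of_norm_le_const (Eventually.of_forall fun ω => ?_)
      rw [norm_mul]
      exact mul_le_one₀ (abs_sub_integral_latentCdf P ξ 0 ω x) (norm_nonneg _)
        (abs_sub_integral_latentCdf P ξ k ω y)
    simpa using h

theorem memLp_empKernelR {Ω : Type*} (X : ℝ≥0 → Ω → ℝ) (S : SamplingScheme) (μ : Measure ℝ)
    [IsFiniteMeasure μ] (p n : ℕ) (ω : Ω) :
    MemLp (Function.uncurry (empKernelR X S μ p n ω)) 2 (μ.prod μ) := by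
  have hm : ∀ t, Measurable fun x => empCdf X S t ω x := fun t => by
    refine measurable_const.mul (Finset.measurable_sum _ fun i _ => ?_)
    exact Measurable.ite (measurableSet_Ici (a := X (S.time t i) ω)) measurable_const
      measurable_const
  have hmean : Measurable fun x => empMean X S n ω x :=
    measurable_const.mul (Finset.measurable_sum _ fun t _ => hm t)
  have hb : ∀ t x, |empCdf X S t ω x| ≤ 1 := fun t x => by
    have h1 : ∀ i ∈ Finset.range (S.q t),
        |(Set.Iic x).indicator (fun _ => (1 : ℝ)) (X (S.time t i) ω)| ≤ 1 := fun i _ => by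
      by_cases h : X (S.time t i) ω ∈ Set.Iic x <;> simp [h]
    have h2 := (Finset.abs_sum_le_sum_abs _ _).trans (Finset.sum_le_card_nsmul _ _ _ h1)
    have hq : (0 : ℝ) < S.q t := by exact_mod_cast S.q_pos t
    rw [empCdf, abs_mul, abs_of_pos (inv_pos.2 hq)]
    rw [Finset.card_range, nsmul_eq_mul, mul_one] at h2
    rw [inv_mul_le_iff₀ hq, mul_one]
    exact h2
  have hbmean : ∃ b, ∀ x, |empMean X S n ω x| ≤ b := by
    refine ⟨|(n : ℝ)⁻¹| * ∑ t ∈ Finset.Icc 1 n, 1, fun x => ?_⟩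
    rw [empMean, abs_mul]
    exact mul_le_mul_of_nonneg_left ((Finset.abs_sum_le_sum_abs _ _).trans
      (Finset.sum_le_sum fun t _ => hb t x)) (abs_nonneg _)
  obtain ⟨b, hbm⟩ := hbmean
  have hd : ∀ t x, |empCdf X S t ω x - empMean X S n ω x| ≤ 1 + b := fun t x =>
    (abs_sub _ _).trans (add_le_add (hb t x) (hbm x))
  refine memLp_sum_integral_mul μ p (fun k => empAutocov X S p n k ω) (fun k => ?_) (fun k => ?_)
  · refine measurable_const.mul (Finset.measurable_sum _ fun t _ => ?_)
    exact (((hm t).sub hmean).comp measurable_fst).mul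
      (((hm (t + k)).sub hmean).comp measurable_snd)
  · refine ⟨|((n : ℝ) - p)⁻¹| * ∑ t ∈ Finset.Icc 1 (n - p), (1 + b) * (1 + b), fun x y => ?_⟩
    rw [empAutocov, abs_mul]
    refine mul_le_mul_of_nonneg_left ((Finset.abs_sum_le_sum_abs _ _).trans
      (Finset.sum_le_sum fun t _ => ?_)) (abs_nonneg _)
    rw [abs_mul]
    exact mul_le_mul (hd t x) (hd (t + k) y) (abs_nonneg _) ((abs_nonneg _).trans (hd t x))

/-- The operator `R^μ` on `L²(μ)`. -/
def opR {Ω : Type*} [MeasurableSpace Ω] (P : Measure Ω) (ξ : ℕ → Ω → ProbabilityMeasure ℝ)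
    (μ : Measure ℝ) [IsFiniteMeasure μ] (p : ℕ) : Module.End ℝ (Lp ℝ 2 μ) :=
  integralOperator μ (kernelR P ξ μ p)

/-- The estimator of `R^μ` from the first `n` cycles. -/
def empOpR {Ω : Type*} (X : ℝ≥0 → Ω → ℝ) (S : SamplingScheme) (μ : Measure ℝ)
    [IsFiniteMeasure μ] (p n : ℕ) (ω : Ω) : Module.End ℝ (Lp ℝ 2 μ) :=
  integralOperator μ (empKernelR X S μ p n ω)

end

end ConjugateProcess

namespace ConjugateProcess

/-- Perturbation of a unit eigenvector. -/
theorem norm_eigenvector_sub_le {E : Type*} [NormedAddCommGroup E]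
    [InnerProductSpace ℝ E] {T T' : E →L[ℝ] E} {t t' : ℝ} {ψ ψ' : E} {K δ : ℝ} (hK0 : 0 ≤ K)
    (hψ : ‖ψ‖ = 1) (hψ' : ‖ψ'‖ = 1)
    (heig : T ψ = t • ψ) (heig' : T' ψ' = t' • ψ')
    (hK : ∀ r, inner ℝ ψ r = 0 → ‖r‖ ≤ K * ‖T r - t • r‖)
    (hδ : ∀ x, ‖T x - T' x‖ ≤ δ * ‖x‖) (ht : |t - t'| ≤ δ) (hsign : 0 ≤ inner ℝ ψ' ψ) :
    ‖ψ' - ψ‖ ≤ 4 * K * δ := by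
  set c : ℝ := inner ℝ ψ' ψ with hc
  have hcc : inner ℝ ψ ψ' = c := real_inner_comm _ _
  have hψψ : inner ℝ ψ ψ = (1 : ℝ) := by rw [real_inner_self_eq_norm_sq, hψ, one_pow]
  have hδ0 : 0 ≤ δ := (abs_nonneg _).trans ht
  let r := ψ' - c • ψ
  have hr : inner ℝ ψ r = 0 := by
    simp only [r, inner_sub_right, real_inner_smul_right, hψψ, hcc]
    ring
  have h1 : T r - t • r = (T ψ' - T' ψ') + (t' - t) • ψ' := by
    simp only [r, map_sub, map_smul, heig, heig']
    module
  have h2 : ‖T r - t • r‖ ≤ 2 * δ := by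
    rw [h1]
    refine (norm_add_le _ _).trans ?_
    have h3 := hδ ψ'
    rw [hψ', mul_one] at h3
    rw [norm_smul, hψ', mul_one, Real.norm_eq_abs, abs_sub_comm]
    linarith
  have h3 : ‖r‖ ≤ K * (2 * δ) := (hK r hr).trans (mul_le_mul_of_nonneg_left h2 hK0)
  have h4 : ‖r‖ ^ 2 = 1 - c ^ 2 := by
    rw [norm_sub_sq_real, norm_smul, hψ, hψ', real_inner_smul_right, ← hc, mul_one,
      Real.norm_eq_abs, sq_abs]
    ring
  have h5 : ‖ψ' - ψ‖ ^ 2 = 2 - 2 * c := by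
    rw [norm_sub_sq_real, hψ, hψ', ← hc]
    ring
  have hc1 : c ≤ 1 := by
    have := real_inner_le_norm ψ' ψ
    rwa [hψ, hψ', mul_one] at this
  refine abs_le_of_sq_le_sq' ?_ (by positivity) |>.2
  have h6 : ‖r‖ ^ 2 ≤ (K * (2 * δ)) ^ 2 := pow_le_pow_left₀ (norm_nonneg _) h3 2
  nlinarith

section CompactOperators

open Module End InnerProductSpace

variable {E : Type*} [NormedAddCommGroup E] [InnerProductSpace ℝ E] [CompleteSpace E]

/-- If all eigenvalues of a compact symmetric operator are at most `c`, then so is its quadratic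
form on unit vectors. -/
theorem inner_apply_self_le_of_hasEigenvalue_le {T : E →L[ℝ] E} (hT : IsCompactOperator T)
    (hs : (T : E →ₗ[ℝ] E).IsSymmetric) {c : ℝ}
    (h : ∀ m, HasEigenvalue (T : End ℝ E) m → m ≤ c) (x : E) :
    inner ℝ (T x) x ≤ c * ‖x‖ ^ 2 := by
  have hd : (⨆ m, eigenspace (T : End ℝ E) m).topologicalClosure = ⊤ :=
    Submodule.topologicalClosure_eq_top_iff.2
      (ContinuousLinearMap.orthogonalComplement_iSup_eigenspaces_eq_bot hT hs)
  have hx : x ∈ closure ((⨆ m, eigenspace (T : End ℝ E) m : Submodule ℝ E) : Set E) := by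
    rw [← Submodule.topologicalClosure_coe, hd]
    trivial
  have hcl : IsClosed {y : E | inner ℝ (T y) y ≤ c * ‖y‖ ^ 2} :=
    isClosed_le (by fun_prop) (by fun_prop)
  refine closure_minimal (fun y hy => ?_) hcl hx
  rw [SetLike.mem_coe, Submodule.mem_iSup_iff_exists_finsupp] at hy
  obtain ⟨f, hf, rfl⟩ := hy
  have hort := hs.orthogonalFamily_eigenspaces
  let g : ∀ m, eigenspace (T : End ℝ E) m := fun m => ⟨f m, hf m⟩
  have hTf : ∀ m, T (f m) = m • f m := fun m => mem_eigenspace_iff.1 (hf m)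
  have h1 := hort.inner_sum g g f.support
  have h2 := hort.inner_sum (fun m => m • g m) g f.support
  change inner ℝ (∑ m ∈ f.support, f m) (∑ m ∈ f.support, f m)
    = ∑ m ∈ f.support, inner ℝ (f m) (f m) at h1
  change inner ℝ (∑ m ∈ f.support, m • f m) (∑ m ∈ f.support, f m)
    = ∑ m ∈ f.support, inner ℝ (m • f m) (f m) at h2
  simp only [Set.mem_ofPred_eq, Finsupp.sum, map_sum, hTf]
  rw [← real_inner_self_eq_norm_sq, h1, h2, Finset.mul_sum]
  refine Finset.sum_le_sum fun m _ => ?_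
  rw [real_inner_smul_left]
  by_cases hm : f m = 0
  · simp [hm]
  · exact mul_le_mul_of_nonneg_right (h m (hasEigenvalue_of_hasEigenvector ⟨hf m, hm⟩))
      real_inner_self_nonneg

/-- An operator on a Hilbert space whose squared norms along finite orthonormal families have
uniformly bounded sum is compact. -/
theorem isCompactOperator_of_sum_sq_le (T : E →L[ℝ] E) (C : ℝ)
    (h : ∀ (w : Set E) (e : w → E), Orthonormal ℝ e → ∀ s : Finset w,
      ∑ i ∈ s, ‖T (e i)‖ ^ 2 ≤ C) : IsCompactOperator T := by
  obtain ⟨w, b, -⟩ := exists_hilbertBasis ℝ E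
  let F : Finset w → E →L[ℝ] E := fun s => ∑ i ∈ s, (innerSL ℝ (b i)).smulRight (T (b i))
  have hsum : Summable fun i => ‖T (b i)‖ ^ 2 :=
    summable_of_sum_le (fun i => sq_nonneg _) (h w b b.orthonormal)
  have hF : ∀ s, IsCompactOperator (F s) := fun s => by
    change F s ∈ compactOperator (RingHom.id ℝ) E E
    refine Submodule.sum_mem _ fun i _ => ?_
    change IsCompactOperator ((ContinuousLinearMap.toSpanSingleton ℝ (T (b i))).comp
      (innerSL ℝ (b i)))
    exact (isCompactOperator_of_locallyCompactSpace_rng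
      (ContinuousLinearMap.toSpanSingleton ℝ (T (b i)))).comp_clm (innerSL ℝ (b i))
  refine isCompactOperator_of_tendsto (l := atTop) (F := F) ?_ (Eventually.of_forall hF)
  rw [Metric.tendsto_nhds]
  intro ε hε
  obtain ⟨s, hs⟩ := summable_iff_vanishing_norm.1 hsum ((ε / 2) ^ 2) (by positivity)
  filter_upwards [eventually_ge_atTop s] with t hst
  have hst' : s ⊆ t := hst
  rw [dist_comm, dist_eq_norm]
  refine lt_of_le_of_lt (ContinuousLinearMap.opNorm_le_bound _ (half_pos hε).le fun x => ?_)
    (half_lt_self hε)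
  have hlim : Tendsto (fun u : Finset w => ‖∑ i ∈ u, inner ℝ (b i) x • T (b i)
      - F t x‖) atTop (𝓝 ‖(T - F t) x‖) := by
    have h1 := (b.hasSum_repr x).mapL T
    simp only [map_smul, b.repr_apply_apply] at h1
    exact (h1.sub_const _).norm
  refine le_of_tendsto hlim ?_
  filter_upwards [eventually_ge_atTop t] with u hu
  have hu' : t ⊆ u := hu
  classical
  have h2 : ∑ i ∈ u, inner ℝ (b i) x • T (b i) - F t x
      = ∑ i ∈ u \ t, inner ℝ (b i) x • T (b i) := by
    rw [← Finset.sum_sdiff hu']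
    simp [F]
  rw [h2]
  have h3 : ∑ i ∈ u \ t, ‖T (b i)‖ ^ 2 ≤ (ε / 2) ^ 2 := by
    have := hs (u \ t) (Finset.disjoint_of_subset_right hst' Finset.sdiff_disjoint)
    exact (le_abs_self _).trans this.le
  have h4 : ∑ i ∈ u \ t, ‖inner ℝ (b i) x‖ ^ 2 ≤ ‖x‖ ^ 2 :=
    b.orthonormal.sum_inner_products_le x
  calc ‖∑ i ∈ u \ t, inner ℝ (b i) x • T (b i)‖
      ≤ ∑ i ∈ u \ t, ‖inner ℝ (b i) x‖ * ‖T (b i)‖ :=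
        (norm_sum_le _ _).trans (Finset.sum_le_sum fun i _ => (norm_smul _ _).le)
    _ ≤ √(∑ i ∈ u \ t, ‖inner ℝ (b i) x‖ ^ 2) * √(∑ i ∈ u \ t, ‖T (b i)‖ ^ 2) :=
        Real.sum_mul_le_sqrt_mul_sqrt _ _ _
    _ ≤ √(‖x‖ ^ 2) * √((ε / 2) ^ 2) :=
        mul_le_mul (Real.sqrt_le_sqrt h4) (Real.sqrt_le_sqrt h3) (Real.sqrt_nonneg _)
          (Real.sqrt_nonneg _)
    _ = ε / 2 * ‖x‖ := by
        rw [Real.sqrt_sq (norm_nonneg _), Real.sqrt_sq (half_pos hε).le, mul_comm]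

/-- The positive part of the eigenvalue sequence of a compact symmetric operator is realised by
orthonormal eigenvectors that span all eigenspaces of positive eigenvalues. -/
theorem IsEigenvalueSeq.exists_eigenvectors {T : E →L[ℝ] E} (hT : IsCompactOperator T)
    (hs : (T : E →ₗ[ℝ] E).IsSymmetric) {θ : ℕ → ℝ} (hθ : IsEigenvalueSeq (T : End ℝ E) θ) :
    ∃ e : ℕ → E, (Orthonormal ℝ fun i : {i // 0 < θ i} => e i) ∧
      (∀ i, 0 < θ i → T (e i) = θ i • e i) ∧
      ∀ c, 0 < c → eigenspace (T : End ℝ E) c ≤ Submodule.span ℝ (e '' {i | θ i = c}) := by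
  have hb : ∀ c : ℝ, 0 < c → ∃ v : ℕ → E, (Orthonormal ℝ fun i : {i | θ i = c} => v i) ∧
      (∀ i, θ i = c → v i ∈ eigenspace (T : End ℝ E) c) ∧
      eigenspace (T : End ℝ E) c ≤ Submodule.span ℝ (v '' {i | θ i = c}) := by
    intro c hc
    have : FiniteDimensional ℝ (eigenspace (T : End ℝ E) c) :=
      ContinuousLinearMap.finite_dimensional_eigenspace hT c hc.ne'
    have hm := hθ.multiplicity c hc
    have hfin : {i | θ i = c}.Finite := by
      rw [← Set.encard_ne_top_iff, hm]
      exact ENat.natCast_ne_top _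
    let _ := hfin.fintype
    have hcard : Fintype.card (Fin (finrank ℝ (eigenspace (T : End ℝ E) c)))
        = Fintype.card {i | θ i = c} := by
      rw [Fintype.card_fin]
      rw [Set.encard_eq_coe_toFinset_card, Set.toFinset_card] at hm
      exact_mod_cast hm.symm
    let b := (stdOrthonormalBasis ℝ (eigenspace (T : End ℝ E) c)).reindex
      (Fintype.equivOfCardEq hcard)
    classical
    let v : ℕ → E := fun i => if h : θ i = c then b ⟨i, h⟩ else 0
    have hv : ∀ i : {i | θ i = c}, v i = b i := fun i => dif_pos i.2
    refine ⟨v, ?_, fun i hi => ?_, fun x hx => ?_⟩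
    · simp only [hv]
      exact b.orthonormal.comp_linearIsometry (eigenspace (T : End ℝ E) c).subtypeₗᵢ
    · rw [hv ⟨i, hi⟩]
      exact (b _).2
    · have h1 := congrArg Subtype.val (b.sum_repr ⟨x, hx⟩)
      change _ = x at h1
      rw [← h1, AddSubmonoidClass.coe_finsetSum]
      refine Submodule.sum_mem _ fun i _ => ?_
      rw [Submodule.coe_smul, ← hv]
      exact Submodule.smul_mem _ _ (Submodule.subset_span ⟨i, i.2, rfl⟩)
  choose v hv1 hv2 hv3 using hb
  classical
  let e : ℕ → E := fun i => if h : 0 < θ i then v (θ i) h i else 0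
  have he : ∀ c (hc : 0 < c) i, θ i = c → e i = v c hc i := by
    rintro c hc i rfl
    exact dif_pos hc
  have heig : ∀ i, 0 < θ i → T (e i) = θ i • e i := fun i hi => by
    rw [he _ hi i rfl]
    exact mem_eigenspace_iff.1 (hv2 _ hi i rfl)
  refine ⟨e, ⟨fun i => ?_, fun i j hij => ?_⟩, heig, fun c hc => ?_⟩
  · change ‖e i‖ = 1
    rw [he _ i.2 i rfl]
    exact (hv1 _ i.2).1 ⟨i, rfl⟩
  · change inner ℝ (e i) (e j) = 0
    by_cases h : θ i = θ j
    · rw [he _ j.2 i h, he _ j.2 j rfl]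
      exact (hv1 _ j.2).2 (i := ⟨i, h⟩) (j := ⟨j, rfl⟩)
        fun h' => hij (Subtype.ext (congrArg (fun k : {k | θ k = θ j} => (k : ℕ)) h'))
    · have h1 := hs (e i) (e j)
      simp only [ContinuousLinearMap.coe_coe, heig _ i.2, heig _ j.2, real_inner_smul_left,
        real_inner_smul_right] at h1
      have h2 : (θ i - θ j) * inner ℝ (e i) (e j) = 0 := by linarith
      exact (mul_eq_zero.1 h2).resolve_left (sub_ne_zero.2 h)
  · refine (hv3 c hc).trans (Submodule.span_mono ?_)
    rintro _ ⟨i, hi, rfl⟩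
    exact ⟨i, hi, he c hc i hi⟩

/-- Weyl's inequality for the eigenvalue sequences of compact symmetric operators. -/
theorem IsEigenvalueSeq.le_add {T T' : E →L[ℝ] E} (hT : IsCompactOperator T)
    (hs : (T : E →ₗ[ℝ] E).IsSymmetric) (hT' : IsCompactOperator T')
    (hs' : (T' : E →ₗ[ℝ] E).IsSymmetric) {θ θ' : ℕ → ℝ}
    (hθ : IsEigenvalueSeq (T : End ℝ E) θ) (hθ' : IsEigenvalueSeq (T' : End ℝ E) θ')
    {δ : ℝ} (hδ : 0 ≤ δ) (h : ∀ x, ‖T x - T' x‖ ≤ δ * ‖x‖) (j : ℕ) : θ j ≤ θ' j + δ := by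
  rcases (hθ.nonneg j).eq_or_lt with hj | hj
  · rw [← hj]
    exact add_nonneg (hθ'.nonneg j) hδ
  obtain ⟨e, he, heig, -⟩ := hθ.exists_eigenvectors hT hs
  obtain ⟨e', -, heig', hspan⟩ := hθ'.exists_eigenvectors hT' hs'
  have hpos : ∀ i : Fin (j + 1), 0 < θ i := fun i =>
    hj.trans_le (hθ.antitone (Nat.lt_succ_iff.1 i.2))
  let u : Fin (j + 1) → E := fun i => e i
  have hu : Orthonormal ℝ u := he.comp (fun i : Fin (j + 1) => ⟨i, hpos i⟩)
    fun a b hab => Fin.ext (congrArg Subtype.val hab)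
  let L : (Fin (j + 1) → ℝ) →ₗ[ℝ] (Fin j → ℝ) :=
    LinearMap.pi fun k => (innerₛₗ ℝ (e' k)).comp (Fintype.linearCombination ℝ u)
  have hL : L.ker ≠ ⊥ := LinearMap.ker_ne_bot_of_finrank_lt (by simp)
  obtain ⟨a, haL, ha⟩ := L.ker.exists_mem_ne_zero_of_ne_bot hL
  let x : E := ∑ i, a i • u i
  have hxe : ∀ k < j, inner ℝ (e' k) x = 0 := fun k hk => by
    have := congrFun (LinearMap.mem_ker.1 haL) ⟨k, hk⟩
    simpa [L, Fintype.linearCombination_apply] using this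
  have hx2 : ‖x‖ ^ 2 = ∑ i, a i * a i := by
    rw [← real_inner_self_eq_norm_sq]
    exact hu.inner_sum a a Finset.univ
  have hTx : inner ℝ (T x) x = ∑ i : Fin (j + 1), θ i * a i * a i := by
    have h1 : T x = ∑ i : Fin (j + 1), (θ i * a i) • u i := by
      simp only [x, map_sum, map_smul]
      refine Finset.sum_congr rfl fun i _ => ?_
      rw [heig i (hpos i), smul_smul, mul_comm]
    rw [h1]
    exact hu.inner_sum (fun i => θ i * a i) a Finset.univ
  have hx0 : 0 < ‖x‖ ^ 2 := by
    obtain ⟨i, hi⟩ := Function.ne_iff.1 ha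
    rw [hx2]
    exact Finset.sum_pos' (fun i _ => mul_self_nonneg _)
      ⟨i, Finset.mem_univ i, mul_self_pos.2 hi⟩
  have hlow : θ j * ‖x‖ ^ 2 ≤ inner ℝ (T x) x := by
    rw [hTx, hx2, Finset.mul_sum]
    refine Finset.sum_le_sum fun i _ => ?_
    rw [mul_assoc]
    exact mul_le_mul_of_nonneg_right (hθ.antitone (Nat.lt_succ_iff.1 i.2)) (mul_self_nonneg _)
  let W : Submodule ℝ E := Submodule.span ℝ (e' '' {k | k < j ∧ 0 < θ' k})
  have hWinv : ∀ y ∈ W, T' y ∈ W := fun y hy => by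
    induction hy using Submodule.span_induction with
    | mem y hy =>
      obtain ⟨k, hk, rfl⟩ := hy
      rw [heig' k hk.2]
      exact W.smul_mem _ (Submodule.subset_span ⟨k, hk, rfl⟩)
    | zero => simp
    | add y z _ _ hy hz => rw [map_add]; exact W.add_mem hy hz
    | smul c y _ hy => rw [map_smul]; exact W.smul_mem c hy
  have hWo : ∀ y ∈ Wᗮ, T' y ∈ Wᗮ := fun y hy => by
    rw [Submodule.mem_orthogonal] at hy ⊢
    intro z hz
    exact (hs' z y).symm.trans (hy _ (hWinv z hz))
  let S : Wᗮ →L[ℝ] Wᗮ := T'.restrict hWo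
  have hS : IsCompactOperator S := hT'.restrict' (f := (T' : E →ₗ[ℝ] E)) hWo
  have hSs : (S : Wᗮ →ₗ[ℝ] Wᗮ).IsSymmetric := hs'.restrict_invariant hWo
  have hSe : ∀ m, HasEigenvalue (S : End ℝ Wᗮ) m → m ≤ θ' j := fun m hm => by
    by_contra! hlt
    obtain ⟨v, hv, hv0⟩ := hm.exists_hasEigenvector
    have hTv : T' (v : E) = m • (v : E) := congrArg Subtype.val (mem_eigenspace_iff.1 hv)
    have hm0 : 0 < m := (hθ'.nonneg j).trans_lt hlt
    have hvW : (v : E) ∈ W := by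
      refine Submodule.span_mono ?_ (hspan m hm0 (mem_eigenspace_iff.2 hTv))
      rintro _ ⟨k, hk, rfl⟩
      have hk : θ' k = m := hk
      refine ⟨k, ⟨?_, hk ▸ hm0⟩, rfl⟩
      by_contra! hkj
      exact (hθ'.antitone hkj).not_gt (hk ▸ hlt)
    exact hv0 (Subtype.ext (inner_self_eq_zero.1 (Submodule.mem_orthogonal W v |>.1 v.2 v hvW)))
  have hxW : x ∈ Wᗮ := by
    have hle : W ≤ (Submodule.span ℝ {x})ᗮ := by
      rw [Submodule.span_le]
      rintro _ ⟨k, hk, rfl⟩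
      rw [SetLike.mem_coe, Submodule.mem_orthogonal_singleton_iff_inner_left]
      exact hxe k hk.1
    rw [Submodule.mem_orthogonal]
    exact fun y hy => Submodule.mem_orthogonal_singleton_iff_inner_left.1 (hle hy)
  have hup : inner ℝ (T' x) x ≤ θ' j * ‖x‖ ^ 2 :=
    inner_apply_self_le_of_hasEigenvalue_le hS hSs hSe ⟨x, hxW⟩
  have hdiff : inner ℝ (T x) x - inner ℝ (T' x) x ≤ δ * ‖x‖ ^ 2 := by
    rw [← inner_sub_left]
    calc inner ℝ (T x - T' x) x ≤ ‖T x - T' x‖ * ‖x‖ := real_inner_le_norm _ _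
      _ ≤ δ * ‖x‖ * ‖x‖ := mul_le_mul_of_nonneg_right (h x) (norm_nonneg _)
      _ = δ * ‖x‖ ^ 2 := by ring
  refine le_of_mul_le_mul_right ?_ hx0
  linarith

/-- Weyl's inequality in absolute value. -/
theorem IsEigenvalueSeq.abs_sub_le {T T' : E →L[ℝ] E} (hT : IsCompactOperator T)
    (hs : (T : E →ₗ[ℝ] E).IsSymmetric) (hT' : IsCompactOperator T')
    (hs' : (T' : E →ₗ[ℝ] E).IsSymmetric) {θ θ' : ℕ → ℝ}
    (hθ : IsEigenvalueSeq (T : End ℝ E) θ) (hθ' : IsEigenvalueSeq (T' : End ℝ E) θ')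
    {δ : ℝ} (hδ : 0 ≤ δ) (h : ∀ x, ‖T x - T' x‖ ≤ δ * ‖x‖) (j : ℕ) : |θ j - θ' j| ≤ δ := by
  have h1 := hθ.le_add hT hs hT' hs' hθ' hδ h j
  have h2 := hθ'.le_add hT' hs' hT hs hθ hδ (fun x => by rw [norm_sub_rev]; exact h x) j
  rw [abs_sub_le_iff]
  constructor <;> linarith

/-- At a simple positive eigenvalue `θ j` with eigenvector `ψ`, the operator `T - θ j` is bounded
below on the orthogonal complement of `ψ`. -/
theorem IsEigenvalueSeq.exists_norm_le {T : E →L[ℝ] E} (hT : IsCompactOperator T)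
    (hs : (T : E →ₗ[ℝ] E).IsSymmetric) {θ : ℕ → ℝ} (hθ : IsEigenvalueSeq (T : End ℝ E) θ)
    {j : ℕ} (hj : 0 < θ j) (hsimple : ∀ i, i ≠ j → θ i ≠ θ j) {ψ : E} (hψ : ‖ψ‖ = 1)
    (heig : T ψ = θ j • ψ) :
    ∃ K : ℝ≥0, ∀ r, inner ℝ ψ r = 0 → ‖r‖ ≤ K * ‖T r - θ j • r‖ := by
  let W : Submodule ℝ E := Submodule.span ℝ {ψ}
  have hWo : ∀ y ∈ Wᗮ, T y ∈ Wᗮ := fun y hy => by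
    rw [Submodule.mem_orthogonal_singleton_iff_inner_right] at hy ⊢
    have h1 := hs ψ y
    simp only [ContinuousLinearMap.coe_coe, heig, real_inner_smul_left, hy, mul_zero] at h1
    exact h1.symm
  let S : Wᗮ →L[ℝ] Wᗮ := T.restrict hWo
  have hS : IsCompactOperator S := hT.restrict' (f := (T : E →ₗ[ℝ] E)) hWo
  have hψ0 : ψ ≠ 0 := fun h0 => by simp [h0] at hψ
  have hne : ¬ HasEigenvalue (S : End ℝ Wᗮ) (θ j) := fun hm => by
    obtain ⟨v, hv, hv0⟩ := hm.exists_hasEigenvector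
    have hTv : T (v : E) = θ j • (v : E) := congrArg Subtype.val (mem_eigenspace_iff.1 hv)
    have hset : {i | θ i = θ j} = {j} := by
      ext i
      exact ⟨fun hi => by_contra fun hij => hsimple i hij hi, fun hi => congrArg θ hi⟩
    have hfr : finrank ℝ (eigenspace (T : End ℝ E) (θ j)) = 1 := by
      have := hθ.multiplicity (θ j) hj
      rw [hset, Set.encard_singleton] at this
      exact_mod_cast this.symm
    obtain ⟨c, hc⟩ := (finrank_eq_one_iff_of_nonzero'
      (⟨ψ, mem_eigenspace_iff.2 heig⟩ : eigenspace (T : End ℝ E) (θ j))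
      fun h0 => hψ0 (congrArg Subtype.val h0)).1 hfr ⟨v, mem_eigenspace_iff.2 hTv⟩
    have hc' : c • ψ = v := congrArg Subtype.val hc
    have hvW : (v : E) ∈ W := hc' ▸ W.smul_mem c (Submodule.mem_span_singleton_self ψ)
    exact hv0 (Subtype.ext (inner_self_eq_zero.1 (Submodule.mem_orthogonal W v |>.1 v.2 v hvW)))
  obtain ⟨K, hK⟩ := hS.antilipschitz_of_not_hasEigenvalue hj.ne' hne
  refine ⟨K, fun r hr => ?_⟩
  have hrW : r ∈ Wᗮ := Submodule.mem_orthogonal_singleton_iff_inner_right.2 hr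
  have := hK.le_mul_dist ⟨r, hrW⟩ 0
  rw [map_zero, dist_zero_right, dist_zero_right] at this
  exact this

end CompactOperators

section IntegralOperators

theorem norm_sq_eq_integral_sq {α : Type*} {mα : MeasurableSpace α} {ν : Measure α}
    (g : Lp ℝ 2 ν) : ‖g‖ ^ 2 = ∫ x, g x ^ 2 ∂ν := by
  rw [← real_inner_self_eq_norm_sq, L2.inner_def]
  exact integral_congr_ae (Eventually.of_forall fun x => by simp [pow_two])

variable {μ : Measure ℝ} [IsFiniteMeasure μ] {K K' : ℝ → ℝ → ℝ}

theorem hsNorm_toReal_sq (hK : MemLp (Function.uncurry K) 2 (μ.prod μ)) :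
    (hsNorm μ K).toReal ^ 2 = ∫ x, ∫ y, K x y ^ 2 ∂μ ∂μ := by
  have h1 : (hsNorm μ K).toReal = ‖hK.toLp‖ := (Lp.norm_toLp _ hK).symm
  rw [h1, norm_sq_eq_integral_sq]
  have h2 : ∫ z, (hK.toLp : ℝ × ℝ → ℝ) z ^ 2 ∂(μ.prod μ)
      = ∫ z, Function.uncurry K z ^ 2 ∂(μ.prod μ) := by
    refine integral_congr_ae ?_
    filter_upwards [hK.coeFn_toLp] with z hz
    rw [hz]
  rw [h2]
  exact integral_prod _ hK.integrable_sq

theorem coeFn_integralOperator (hK : MemLp (Function.uncurry K) 2 (μ.prod μ)) (f : Lp ℝ 2 μ) :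
    integralOperator μ K f =ᵐ[μ] fun x => ∫ y, K x y * f y ∂μ := by
  rw [integralOperator, dif_pos hK]
  exact (memLp_integral_kernel hK f).coeFn_toLp

theorem sum_norm_sq_integralOperator_le (hK : MemLp (Function.uncurry K) 2 (μ.prod μ))
    {ι : Type*} (s : Finset ι) (e : ι → Lp ℝ 2 μ) (B : ℝ)
    (he : ∀ g : Lp ℝ 2 μ, ∑ i ∈ s, inner ℝ g (e i) ^ 2 ≤ B * ‖g‖ ^ 2) :
    ∑ i ∈ s, ‖integralOperator μ K (e i)‖ ^ 2 ≤ B * (hsNorm μ K).toReal ^ 2 := by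
  have h1 : ∀ i, ‖integralOperator μ K (e i)‖ ^ 2 = ∫ x, (∫ y, K x y * e i y ∂μ) ^ 2 ∂μ :=
    fun i => by
      rw [norm_sq_eq_integral_sq]
      refine integral_congr_ae ?_
      filter_upwards [coeFn_integralOperator hK (e i)] with x hx
      rw [hx]
  simp only [h1]
  rw [← integral_finsetSum _ fun i _ => (memLp_integral_kernel hK (e i)).integrable_sq,
    hsNorm_toReal_sq hK, ← integral_const_mul]
  refine integral_mono_ae
    (integrable_finsetSum _ fun i _ => (memLp_integral_kernel hK (e i)).integrable_sq)
    (hK.integrable_sq.integral_prod_left.const_mul B) ?_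
  filter_upwards [memLp_section hK] with x hx
  have h2 : ∀ i, ∫ y, K x y * e i y ∂μ = inner ℝ (hx.toLp (K x)) (e i) := fun i => by
    rw [L2.inner_def]
    refine integral_congr_ae ?_
    filter_upwards [hx.coeFn_toLp] with y hy
    simp [hy, mul_comm]
  have h3 : ∫ y, K x y ^ 2 ∂μ = ‖hx.toLp (K x)‖ ^ 2 := by
    rw [norm_sq_eq_integral_sq]
    refine integral_congr_ae ?_
    filter_upwards [hx.coeFn_toLp] with y hy
    rw [hy]
  change ∑ i ∈ s, (∫ y, K x y * e i y ∂μ) ^ 2 ≤ B * ∫ y, K x y ^ 2 ∂μ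
  simp only [h2, h3]
  exact he _

theorem norm_integralOperator_le (hK : MemLp (Function.uncurry K) 2 (μ.prod μ))
    (f : Lp ℝ 2 μ) : ‖integralOperator μ K f‖ ≤ (hsNorm μ K).toReal * ‖f‖ := by
  have h := sum_norm_sq_integralOperator_le hK {()} (fun _ => f) (‖f‖ ^ 2) fun g => by
    rw [Finset.sum_singleton, ← mul_pow, ← sq_abs]
    refine pow_le_pow_left₀ (abs_nonneg _) ?_ 2
    rw [mul_comm]
    exact abs_real_inner_le_norm _ _
  rw [Finset.sum_singleton, ← mul_pow] at h
  rw [mul_comm]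
  exact abs_le_of_sq_le_sq' h (by positivity) |>.2

/-- The integral operator with kernel in `L²(μ ⊗ μ)` as a bounded operator. -/
noncomputable def integralCLM (hK : MemLp (Function.uncurry K) 2 (μ.prod μ)) :
    Lp ℝ 2 μ →L[ℝ] Lp ℝ 2 μ :=
  (integralOperator μ K).mkContinuous _ (norm_integralOperator_le hK)

theorem isCompactOperator_integralCLM (hK : MemLp (Function.uncurry K) 2 (μ.prod μ)) :
    IsCompactOperator (integralCLM hK) := by
  refine isCompactOperator_of_sum_sq_le _ (1 * (hsNorm μ K).toReal ^ 2) fun w e he s => ?_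
  refine sum_norm_sq_integralOperator_le hK s e 1 fun g => ?_
  have := he.sum_inner_products_le g (s := s)
  simpa [real_inner_comm] using this

theorem isSymmetric_integralOperator (hK : MemLp (Function.uncurry K) 2 (μ.prod μ))
    (hsymm : ∀ x y, K x y = K y x) : (integralOperator μ K).IsSymmetric := by
  intro f g
  have hint : Integrable (fun z : ℝ × ℝ => K z.1 z.2 * f z.2 * g z.1) (μ.prod μ) := by
    have h1 : MemLp (fun z : ℝ × ℝ => g z.1 * f z.2) 2 (μ.prod μ) := by
      have hm : AEStronglyMeasurable (fun z : ℝ × ℝ => g z.1 * f z.2) (μ.prod μ) :=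
        (Lp.aestronglyMeasurable g).comp_fst.mul (Lp.aestronglyMeasurable f).comp_snd
      rw [memLp_two_iff_integrable_sq hm]
      simp only [mul_pow]
      exact (Lp.memLp g).integrable_sq.mul_prod (Lp.memLp f).integrable_sq
    refine (hK.integrable_mul h1).congr (Eventually.of_forall fun z => ?_)
    simp only [Pi.mul_apply, Function.uncurry]
    ring
  have h1 : inner ℝ (integralOperator μ K f) g = ∫ x, ∫ y, K x y * f y * g x ∂μ ∂μ := by
    rw [L2.inner_def]
    refine integral_congr_ae ?_
    filter_upwards [coeFn_integralOperator hK f] with x hx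
    simp only [hx, RCLike.inner_apply, conj_trivial]
    rw [integral_mul_const, mul_comm]
  have h2 : inner ℝ f (integralOperator μ K g) = ∫ y, ∫ x, K x y * f y * g x ∂μ ∂μ := by
    rw [L2.inner_def]
    refine integral_congr_ae ?_
    filter_upwards [coeFn_integralOperator hK g] with y hy
    simp only [hy, RCLike.inner_apply, conj_trivial]
    rw [← integral_mul_const]
    refine integral_congr_ae (Eventually.of_forall fun x => ?_)
    simp only [hsymm x y]
    ring
  rw [h1, h2]
  exact integral_integral_swap hint

theorem norm_integralOperator_sub_le (hK : MemLp (Function.uncurry K) 2 (μ.prod μ))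
    (hK' : MemLp (Function.uncurry K') 2 (μ.prod μ)) (f : Lp ℝ 2 μ) :
    ‖integralOperator μ K f - integralOperator μ K' f‖
      ≤ (hsNorm μ fun x y => K x y - K' x y).toReal * ‖f‖ := by
  have hd : MemLp (Function.uncurry fun x y => K x y - K' x y) 2 (μ.prod μ) := hK.sub hK'
  have h : integralOperator μ K f - integralOperator μ K' f
      = integralOperator μ (fun x y => K x y - K' x y) f := by
    refine Lp.ext ?_
    filter_upwards [Lp.coeFn_sub (integralOperator μ K f) (integralOperator μ K' f),
      coeFn_integralOperator hK f, coeFn_integralOperator hK' f, coeFn_integralOperator hd f,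
      memLp_section hK, memLp_section hK'] with x h1 h2 h3 h4 h5 h6
    rw [h1, Pi.sub_apply, h2, h3, h4]
    simp only [sub_mul]
    exact (integral_sub (h5.integrable_mul (Lp.memLp f)) (h6.integrable_mul (Lp.memLp f))).symm
  rw [h]
  exact norm_integralOperator_le hd f

end IntegralOperators

section Mixing

variable {Ω : Type*} {𝒜 ℬ : MeasurableSpace Ω} {mΩ : MeasurableSpace Ω} {P : Measure Ω} [IsProbabilityMeasure P]

theorem measure_inter_le_psiCoeff {A B : Set Ω}
    (hA : MeasurableSet[𝒜] A) (hB : MeasurableSet[ℬ] B) :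
    P (A ∩ B) ≤ (1 + psiCoeff P 𝒜 ℬ) * P A * P B := by
  by_cases hA0 : P A = 0
  · rw [measure_mono_null Set.inter_subset_left hA0]
    exact zero_le
  by_cases hB0 : P B = 0
  · rw [measure_mono_null Set.inter_subset_right hB0]
    exact zero_le
  have h1 : ENNReal.ofReal |P.real (A ∩ B) / (P.real A * P.real B) - 1| ≤ psiCoeff P 𝒜 ℬ :=
    le_iSup_of_le A <| le_iSup_of_le B <| le_iSup_of_le hA <| le_iSup_of_le hB <|
      le_iSup_of_le hA0 <| le_iSup_of_le hB0 le_rfl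
  refine le_trans ?_ (mul_le_mul_left (mul_le_mul_left (add_le_add_right h1 1) _) _)
  have hA' : 0 < P.real A := ENNReal.toReal_pos hA0 (measure_ne_top _ _)
  have hB' : 0 < P.real B := ENNReal.toReal_pos hB0 (measure_ne_top _ _)
  rw [← ofReal_measureReal (s := A ∩ B), ← ofReal_measureReal (s := A),
    ← ofReal_measureReal (s := B), ← ENNReal.ofReal_one,
    ← ENNReal.ofReal_add zero_le_one (abs_nonneg _), ← ENNReal.ofReal_mul (by positivity),
    ← ENNReal.ofReal_mul (by positivity)]
  refine ENNReal.ofReal_le_ofReal ?_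
  have h2 : P.real (A ∩ B) / (P.real A * P.real B)
      ≤ 1 + |P.real (A ∩ B) / (P.real A * P.real B) - 1| := by
    linarith [le_abs_self (P.real (A ∩ B) / (P.real A * P.real B) - 1)]
  rw [div_le_iff₀ (by positivity)] at h2
  linarith

theorem lintegral_mul_le_psiCoeff (h𝒜 : 𝒜 ≤ mΩ) (hℬ : ℬ ≤ mΩ)
    {f g : Ω → ℝ≥0∞} (hf : Measurable[𝒜] f) (hg : Measurable[ℬ] g) :
    ∫⁻ ω, f ω * g ω ∂P ≤ (1 + psiCoeff P 𝒜 ℬ) * (∫⁻ ω, f ω ∂P) * ∫⁻ ω, g ω ∂P := by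
  set c := 1 + psiCoeff P 𝒜 ℬ
  have h1 : ∀ B, MeasurableSet[ℬ] B → ∫⁻ ω in B, f ω ∂P ≤ c * P B * ∫⁻ ω, f ω ∂P := by
    intro B hB
    have hle : (P.restrict B).trim h𝒜 ≤ (c * P B) • P.trim h𝒜 := by
      refine Measure.le_iff.2 fun A hA => ?_
      rw [Measure.smul_apply, smul_eq_mul, trim_measurableSet_eq h𝒜 hA,
        trim_measurableSet_eq h𝒜 hA, Measure.restrict_apply (h𝒜 A hA), mul_right_comm]
      exact measure_inter_le_psiCoeff hA hB
    rw [← lintegral_trim h𝒜 hf, ← lintegral_trim (μ := P) h𝒜 hf, ← smul_eq_mul,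
      ← lintegral_smul_measure]
    exact lintegral_mono' hle le_rfl
  have hfm : Measurable f := hf.mono h𝒜 le_rfl
  have hgm : Measurable g := hg.mono hℬ le_rfl
  have hle : (P.withDensity f).trim hℬ ≤ (c * ∫⁻ ω, f ω ∂P) • P.trim hℬ := by
    refine Measure.le_iff.2 fun B hB => ?_
    rw [Measure.smul_apply, smul_eq_mul, trim_measurableSet_eq hℬ hB,
      trim_measurableSet_eq hℬ hB, withDensity_apply _ (hℬ B hB), mul_right_comm]
    exact h1 B hB
  have h2 : ∫⁻ ω, f ω * g ω ∂P = ∫⁻ ω, g ω ∂(P.withDensity f) := by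
    rw [lintegral_withDensity_eq_lintegral_mul _ hfm hgm]
    rfl
  rw [h2, ← lintegral_trim hℬ hg, ← lintegral_trim (μ := P) hℬ hg, ← smul_eq_mul,
    ← lintegral_smul_measure]
  exact lintegral_mono' hle le_rfl

theorem memLp_of_abs_le {Z : Ω → ℝ} (hZ : Measurable Z) {b : ℝ} (hb : ∀ ω, |Z ω| ≤ b) (q : ℝ≥0∞) :
    MemLp Z q P :=
  MemLp.of_bound hZ.aestronglyMeasurable b (Eventually.of_forall hb)

theorem covariance_le_psiCoeff_of_mem_Icc (h𝒜 : 𝒜 ≤ mΩ) (hℬ : ℬ ≤ mΩ)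
    (hc : psiCoeff P 𝒜 ℬ ≠ ∞) {U V : Ω → ℝ} (hU : Measurable[𝒜] U) (hV : Measurable[ℬ] V)
    (hU1 : ∀ ω, U ω ∈ Set.Icc (0 : ℝ) 1) (hV1 : ∀ ω, V ω ∈ Set.Icc (0 : ℝ) 1) :
    cov[U, V; P] ≤ (psiCoeff P 𝒜 ℬ).toReal := by
  have hUm : Measurable U := hU.mono h𝒜 le_rfl
  have hVm : Measurable V := hV.mono hℬ le_rfl
  have hUa : ∀ ω, |U ω| ≤ 1 := fun ω => by rw [abs_of_nonneg (hU1 ω).1]; exact (hU1 ω).2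
  have hVa : ∀ ω, |V ω| ≤ 1 := fun ω => by rw [abs_of_nonneg (hV1 ω).1]; exact (hV1 ω).2
  have hUL := fun q => memLp_of_abs_le (P := P) hUm hUa q
  have hVL := fun q => memLp_of_abs_le (P := P) hVm hVa q
  have hUVi : Integrable (U * V) P := (hUL 2).integrable_mul (hVL 2)
  have hUi : Integrable U P := memLp_one_iff_integrable.1 (hUL 1)
  have hVi : Integrable V P := memLp_one_iff_integrable.1 (hVL 1)
  have h := lintegral_mul_le_psiCoeff (P := P) h𝒜 hℬ hU.ennreal_ofReal hV.ennreal_ofReal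
  simp only [← ENNReal.ofReal_mul (hU1 _).1] at h
  have hI1 : ∫⁻ ω, ENNReal.ofReal (U ω * V ω) ∂P = ENNReal.ofReal (∫ ω, (U * V) ω ∂P) :=
    (ofReal_integral_eq_lintegral_ofReal hUVi
      (Eventually.of_forall fun ω => mul_nonneg (hU1 ω).1 (hV1 ω).1)).symm
  rw [hI1, ← ofReal_integral_eq_lintegral_ofReal hUi (Eventually.of_forall fun ω => (hU1 ω).1),
    ← ofReal_integral_eq_lintegral_ofReal hVi (Eventually.of_forall fun ω => (hV1 ω).1),
    ← ENNReal.ofReal_toReal hc, ← ENNReal.ofReal_one,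
    ← ENNReal.ofReal_add zero_le_one ENNReal.toReal_nonneg,
    ← ENNReal.ofReal_mul (by positivity)] at h
  have hU0 : 0 ≤ ∫ ω, U ω ∂P := integral_nonneg fun ω => (hU1 ω).1
  have hV0 : 0 ≤ ∫ ω, V ω ∂P := integral_nonneg fun ω => (hV1 ω).1
  rw [← ENNReal.ofReal_mul (by positivity), ENNReal.ofReal_le_ofReal_iff (by positivity)] at h
  have hUle : ∫ ω, U ω ∂P ≤ 1 := by
    simpa using integral_mono hUi (integrable_const (1 : ℝ)) fun ω => (hU1 ω).2
  have hVle : ∫ ω, V ω ∂P ≤ 1 := by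
    simpa using integral_mono hVi (integrable_const (1 : ℝ)) fun ω => (hV1 ω).2
  rw [covariance_eq_sub (hUL 2) (hVL 2)]
  have h3 : (psiCoeff P 𝒜 ℬ).toReal * ((∫ ω, U ω ∂P) * ∫ ω, V ω ∂P)
      ≤ (psiCoeff P 𝒜 ℬ).toReal * 1 :=
    mul_le_mul_of_nonneg_left (mul_le_one₀ hUle hV0 hVle) ENNReal.toReal_nonneg
  linarith

/-- Covariance inequality for the `ψ`-dependence coefficient. -/
theorem covariance_le_psiCoeff (h𝒜 : 𝒜 ≤ mΩ) (hℬ : ℬ ≤ mΩ)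
    (hc : psiCoeff P 𝒜 ℬ ≠ ∞) {U V : Ω → ℝ} (hU : Measurable[𝒜] U) (hV : Measurable[ℬ] V)
    (hU1 : ∀ ω, |U ω| ≤ 1) (hV1 : ∀ ω, |V ω| ≤ 1) :
    cov[U, V; P] ≤ 4 * (psiCoeff P 𝒜 ℬ).toReal := by
  have h := covariance_le_psiCoeff_of_mem_Icc (P := P) h𝒜 hℬ hc
    (U := fun ω => 1 / 2 * U ω + 1 / 2) (V := fun ω => 1 / 2 * V ω + 1 / 2)
    ((hU.const_mul _).add_const _) ((hV.const_mul _).add_const _)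
    (fun ω => by have := abs_le.1 (hU1 ω); constructor <;> linarith)
    (fun ω => by have := abs_le.1 (hV1 ω); constructor <;> linarith)
  have hUi : Integrable U P :=
    memLp_one_iff_integrable.1 (memLp_of_abs_le (hU.mono h𝒜 le_rfl) hU1 1)
  have hVi : Integrable V P :=
    memLp_one_iff_integrable.1 (memLp_of_abs_le (hV.mono hℬ le_rfl) hV1 1)
  rw [covariance_add_const_left (hUi.const_mul _), covariance_add_const_right (hVi.const_mul _),
    covariance_const_mul_left, covariance_const_mul_right] at h
  linarith

theorem covariance_le_two {U V : Ω → ℝ} (hU : Measurable U) (hV : Measurable V)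
    (hU1 : ∀ ω, |U ω| ≤ 1) (hV1 : ∀ ω, |V ω| ≤ 1) : cov[U, V; P] ≤ 2 := by
  rw [covariance_eq_sub (memLp_of_abs_le hU hU1 2) (memLp_of_abs_le hV hV1 2)]
  have hI : ∀ W : Ω → ℝ, (∀ ω, |W ω| ≤ 1) → |∫ ω, W ω ∂P| ≤ 1 := fun W hW => by
    have h := norm_integral_le_of_norm_le_const (μ := P) (f := W) (Eventually.of_forall hW)
    rwa [probReal_univ, mul_one, Real.norm_eq_abs] at h
  have h1 := hI (U * V) fun ω => by
    rw [Pi.mul_apply, abs_mul]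
    exact mul_le_one₀ (hU1 ω) (abs_nonneg _) (hV1 ω)
  have h2 : |(∫ ω, U ω ∂P) * ∫ ω, V ω ∂P| ≤ 1 := by
    rw [abs_mul]
    exact mul_le_one₀ (hI U hU1) (abs_nonneg _) (hI V hV1)
  linarith [(abs_le.1 h1).2, (abs_le.1 h2).1]

theorem variance_sum_le_of_covariance_le {Z : ℕ → Ω → ℝ} (hZ : ∀ t, MemLp (Z t) 2 P)
    {a : ℕ → ℝ} (ha : ∀ l, 0 ≤ a l) (hsum : Summable a)
    (hcov : ∀ s t, s ≤ t → cov[Z s, Z t; P] ≤ a (t - s)) (N : ℕ) :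
    Var[fun ω => ∑ t ∈ Finset.range N, Z t ω; P] ≤ 2 * (∑' l, a l) * N := by
  rw [variance_fun_sum' fun t _ => hZ t]
  have h1 : ∀ s ∈ Finset.range N, ∑ t ∈ Finset.range N, cov[Z s, Z t; P] ≤ 2 * ∑' l, a l := by
    intro s _
    have h2 : ∀ t ∈ Finset.range N, cov[Z s, Z t; P]
        ≤ (if s ≤ t then a (t - s) else 0) + (if t ≤ s then a (s - t) else 0) := by
      intro t _
      rcases le_total s t with h | h
      · rw [if_pos h]
        refine (hcov s t h).trans (le_add_of_nonneg_right ?_)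
        split_ifs
        exacts [ha _, le_rfl]
      · rw [if_pos h, covariance_comm]
        refine (hcov t s h).trans (le_add_of_nonneg_left ?_)
        split_ifs
        exacts [ha _, le_rfl]
    refine (Finset.sum_le_sum h2).trans ?_
    rw [Finset.sum_add_distrib, ← Finset.sum_filter, ← Finset.sum_filter, two_mul]
    refine add_le_add ?_ ?_
    · rw [← Finset.sum_image (f := a) (g := fun t => t - s) fun x hx y hy hxy => ?_]
      · exact hsum.sum_le_tsum _ fun l _ => ha l
      · simp only [Finset.coe_filter, Set.mem_ofPred_eq] at hx hy
        simp only at hxy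
        omega
    · rw [← Finset.sum_image (f := a) (g := fun t => s - t) fun x hx y hy hxy => ?_]
      · exact hsum.sum_le_tsum _ fun l _ => ha l
      · simp only [Finset.coe_filter, Set.mem_ofPred_eq] at hx hy
        simp only at hxy
        omega
  refine (Finset.sum_le_sum h1).trans (le_of_eq ?_)
  rw [Finset.sum_const, Finset.card_range, nsmul_eq_mul, mul_comm]

theorem summable_of_tsum_mul_rpow_lt_top {Ψ : ℕ → ℝ≥0∞}
    (h : ∑' k : ℕ, (k : ℝ≥0∞) * Ψ k ^ (1 / 2 : ℝ) < ∞) :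
    (∀ k, Ψ (k + 1) ≠ ∞) ∧ Summable fun k => (Ψ (k + 1)).toReal := by
  have hfin : ∀ k, Ψ (k + 1) ≠ ∞ := fun k hk => by
    have h1 := ENNReal.ne_top_of_tsum_ne_top h.ne (k + 1)
    rw [hk, ENNReal.top_rpow_of_pos (by norm_num), ENNReal.mul_top (by simp)] at h1
    exact h1 rfl
  refine ⟨hfin, ?_⟩
  have hb := (summable_nat_add_iff 1).2 (ENNReal.summable_toReal h.ne)
  have h0 := hb.tendsto_atTop_zero
  refine Summable.of_norm_bounded_eventually_nat hb ?_
  filter_upwards [h0.eventually_le_const zero_lt_one] with k hk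
  rw [Real.norm_of_nonneg ENNReal.toReal_nonneg]
  simp only [ENNReal.toReal_mul, ← ENNReal.toReal_rpow, ENNReal.toReal_natCast] at hk ⊢
  set x := (Ψ (k + 1)).toReal
  have hx : 0 ≤ x := ENNReal.toReal_nonneg
  rw [← Real.sqrt_eq_rpow] at hk ⊢
  have hs : √x * √x = x := Real.mul_self_sqrt hx
  have hs0 := Real.sqrt_nonneg x
  have hle : √x ≤ ((k + 1 : ℕ) : ℝ) * √x := le_mul_of_one_le_left hs0 (by simp)
  nlinarith

/-- Sums of bounded local functionals of a `ψ`-mixing sequence with summable coefficients have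
variance of linear order, uniformly in the functional. -/
theorem exists_variance_sum_le {E : Type*} [mE : MeasurableSpace E] {Y : ℕ → Ω → E}
    (hY : ∀ t, Measurable (Y t))
    (hsum : ∑' k : ℕ, (k : ℝ≥0∞) * psiMixingCoeff P Y k ^ (1 / 2 : ℝ) < ∞) (k : ℕ) :
    ∃ C : ℝ, 0 ≤ C ∧ ∀ f : E → E → ℝ, Measurable (Function.uncurry f) →
      (∀ t ω, |f (Y t ω) (Y (t + k) ω)| ≤ 1) → ∀ N : ℕ, Var[fun ω => ∑ t ∈ Finset.range N, f (Y t ω) (Y (t + k) ω); P] ≤ C * N := by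
  obtain ⟨hfin, hs⟩ := summable_of_tsum_mul_rpow_lt_top hsum
  let a : ℕ → ℝ := fun l =>
    if l ≤ k then 2 else 4 * (psiMixingCoeff P Y (l - k - 1 + 1)).toReal
  have ha : ∀ l, 0 ≤ a l := fun l => by
    simp only [a]
    split_ifs <;> positivity
  have hasum : Summable a := by
    rw [← summable_nat_add_iff (k + 1)]
    refine (hs.mul_left 4).congr fun l => ?_
    simp only [a]
    rw [if_neg (by omega)]
    congr 4
    omega
  refine ⟨2 * ∑' l, a l, mul_nonneg zero_le_two (tsum_nonneg ha), fun f hf hf1 N => ?_⟩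
  have hm : ∀ (m : MeasurableSpace Ω) t, mE.comap (Y t) ≤ m → mE.comap (Y (t + k)) ≤ m →
      Measurable[m] fun ω => f (Y t ω) (Y (t + k) ω) := fun m t h1 h2 =>
    hf.comp (((comap_measurable (Y t)).mono h1 le_rfl).prodMk
      ((comap_measurable (Y (t + k))).mono h2 le_rfl))
  have hZm : ∀ t, Measurable fun ω => f (Y t ω) (Y (t + k) ω) := fun t =>
    hm mΩ t (hY t).comap_le (hY (t + k)).comap_le
  refine variance_sum_le_of_covariance_le (P := P) (Z := fun t ω => f (Y t ω) (Y (t + k) ω))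
    (fun t => memLp_of_abs_le (hZm t) (fun ω => hf1 _ _) 2) ha hasum (fun s t hst => ?_) N
  by_cases hl : t - s ≤ k
  · simp only [a, if_pos hl]
    exact covariance_le_two (hZm s) (hZm t) (fun ω => hf1 _ _) fun ω => hf1 _ _
  · simp only [a, if_neg hl]
    set l := t - s - k - 1 + 1 with hldef
    have hle : psiCoeff P (⨆ (i : ℕ) (_ : i ≤ s + k), mE.comap (Y i))
        (⨆ (i : ℕ) (_ : s + k + l ≤ i), mE.comap (Y i)) ≤ psiMixingCoeff P Y l :=
      le_iSup (fun j => psiCoeff P (⨆ (i : ℕ) (_ : i ≤ j), mE.comap (Y i))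
        (⨆ (i : ℕ) (_ : j + l ≤ i), mE.comap (Y i))) (s + k)
    have hne : psiMixingCoeff P Y l ≠ ∞ := hfin _
    refine (covariance_le_psiCoeff (𝒜 := ⨆ (i : ℕ) (_ : i ≤ s + k), mE.comap (Y i))
      (ℬ := ⨆ (i : ℕ) (_ : s + k + l ≤ i), mE.comap (Y i)) (iSup₂_le fun i _ => (hY i).comap_le)
      (iSup₂_le fun i _ => (hY i).comap_le) (ne_top_of_le_ne_top hne hle)
      (hm _ s ?_ ?_) (hm _ t ?_ ?_) (fun ω => hf1 _ _) fun ω => hf1 _ _).trans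
      (mul_le_mul_of_nonneg_left (ENNReal.toReal_mono hne hle) (by norm_num))
    · exact le_iSup₂_of_le s (by omega) le_rfl
    · exact le_iSup₂_of_le (s + k) (by omega) le_rfl
    · exact le_iSup₂_of_le t (by omega) le_rfl
    · exact le_iSup₂_of_le (t + k) (by omega) le_rfl

end Mixing

section Moments

theorem empCdf_mem {Ω : Type*} (X : ℝ≥0 → Ω → ℝ) (S : SamplingScheme) (t : ℕ) (ω : Ω) (x : ℝ) :
    empCdf X S t ω x ∈ Set.Icc (0 : ℝ) 1 := by
  have hq : (0 : ℝ) < S.q t := by exact_mod_cast S.q_pos t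
  have hi : ∀ i, (Set.Iic x).indicator (fun _ => (1 : ℝ)) (X (S.time t i) ω) ∈ Set.Icc (0 : ℝ) 1 :=
    fun i => by by_cases h : X (S.time t i) ω ∈ Set.Iic x <;> simp [h]
  refine ⟨mul_nonneg (inv_pos.2 hq).le (Finset.sum_nonneg fun i _ => (hi i).1), ?_⟩
  rw [empCdf, inv_mul_le_iff₀ hq, mul_one]
  refine (Finset.sum_le_sum fun i _ => (hi i).2).trans ?_
  simp

theorem abs_latentCdf_le_one {Ω : Type*} (ξ : ℕ → Ω → ProbabilityMeasure ℝ) (t : ℕ) (ω : Ω) (x : ℝ) :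
    |latentCdf ξ t ω x| ≤ 1 := by
  rw [abs_of_nonneg (latentCdf_mem ξ t ω x).1]
  exact (latentCdf_mem ξ t ω x).2

theorem IsConjugateProcess.latentSigma_le {Ω : Type*} [mΩ : MeasurableSpace Ω] {P : Measure Ω}
    {ξ : ℕ → Ω → ProbabilityMeasure ℝ} {X : ℝ≥0 → Ω → ℝ} (h : IsConjugateProcess P ξ X) :
    latentSigma ξ ≤ mΩ :=
  iSup_le fun t => (h.measurable_latent t).comap_le

theorem sum_Icc_one_eq_sum_range (f : ℕ → ℝ) (N : ℕ) :
    ∑ t ∈ Finset.Icc 1 N, f t = ∑ t ∈ Finset.range N, f (t + 1) := by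
  induction N with
  | zero => simp
  | succ N ih => rw [Finset.sum_Icc_succ_top (by omega), ih, Finset.sum_range_succ]

variable {Ω : Type*} [mΩ : MeasurableSpace Ω] {P : Measure Ω}
  {ξ : ℕ → Ω → ProbabilityMeasure ℝ} {X : ℝ≥0 → Ω → ℝ}

/-- The mean distribution function `E F_0`. -/
noncomputable def meanCdf (P : Measure Ω) (ξ : ℕ → Ω → ProbabilityMeasure ℝ) (x : ℝ) : ℝ :=
  ∫ ω, latentCdf ξ 0 ω x ∂P

theorem measurable_real_Iic (x : ℝ) :
    Measurable fun ν : ProbabilityMeasure ℝ => (ν : Measure ℝ).real (Set.Iic x) :=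
  ((Measure.measurable_coe measurableSet_Iic).comp measurable_subtype_coe).ennreal_toReal

theorem IsStationary.integral_latentCdf (h : IsStationary P ξ) (t : ℕ) (x : ℝ) :
    ∫ ω, latentCdf ξ t ω x ∂P = meanCdf P ξ x := by
  have h1 := ((h t).comp ((measurable_real_Iic x).comp (measurable_pi_apply 0))).integral_eq
  simp only [Function.comp_def, zero_add] at h1
  exact h1

theorem IsStationary.integral_latentCdf_mul (h : IsStationary P ξ) (t k : ℕ) (x y : ℝ) :
    ∫ ω, latentCdf ξ t ω x * latentCdf ξ (t + k) ω y ∂P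
      = ∫ ω, latentCdf ξ 0 ω x * latentCdf ξ k ω y ∂P := by
  have h1 := ((h t).comp (((measurable_real_Iic x).comp (measurable_pi_apply 0)).mul
    ((measurable_real_Iic y).comp (measurable_pi_apply k)))).integral_eq
  simp only [Function.comp_def, Pi.mul_apply, zero_add, add_comm k t] at h1
  exact h1

variable [IsProbabilityMeasure P]

theorem IsConjugateProcess.integral_indicator (h : IsConjugateProcess P ξ X) {t : ℕ} {τ : ℝ≥0}
    (hτ : τ ∈ cycle t) (x : ℝ) :
    ∫ ω, (Set.Iic x).indicator (fun _ => (1 : ℝ)) (X τ ω) ∂P = ∫ ω, latentCdf ξ t ω x ∂P := by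
  have h1 := h.compatible t τ hτ (Set.Iic x) measurableSet_Iic
  have h2 := integral_condExp (μ := P) (f := (X τ ⁻¹' Set.Iic x).indicator fun _ => (1 : ℝ))
    h.latentSigma_le
  exact h2.symm.trans (integral_congr_ae h1)

theorem IsConjugateProcess.integral_indicator_mul (h : IsConjugateProcess P ξ X)
    (hcyc : IsCyclicIndependent P ξ X) {s t : ℕ} (hst : s ≠ t) {σ τ : ℝ≥0}
    (hσ : σ ∈ cycle s) (hτ : τ ∈ cycle t) (x y : ℝ) :
    ∫ ω, (Set.Iic x).indicator (fun _ => (1 : ℝ)) (X σ ω) *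
        (Set.Iic y).indicator (fun _ => (1 : ℝ)) (X τ ω) ∂P
      = ∫ ω, latentCdf ξ s ω x * latentCdf ξ t ω y ∂P := by
  let A : ℕ → Set Ω := fun u => if u = s then X σ ⁻¹' Set.Iic x else X τ ⁻¹' Set.Iic y
  have hAs : A s = X σ ⁻¹' Set.Iic x := if_pos rfl
  have hAt : A t = X τ ⁻¹' Set.Iic y := if_neg hst.symm
  have hm : ∀ (u : ℕ) (ρ : ℝ≥0), ρ ∈ cycle u → ∀ z : ℝ,
      MeasurableSet[cycleSigma X u] (X ρ ⁻¹' Set.Iic z) := fun u ρ hρ z => by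
    have hle : MeasurableSpace.comap (X ρ) inferInstance ≤ cycleSigma X u :=
      le_iSup₂ (f := fun ρ (_ : ρ ∈ cycle u) => MeasurableSpace.comap (X ρ) inferInstance) ρ hρ
    exact hle _ ⟨Set.Iic z, measurableSet_Iic, rfl⟩
  have h1 := hcyc {s, t} A fun u hu => by
    rcases Finset.mem_insert.1 hu with rfl | hu
    · rw [hAs]
      exact hm _ σ hσ x
    · rw [Finset.mem_singleton.1 hu, hAt]
      exact hm _ τ hτ y
  have hI : ⋂ u ∈ ({s, t} : Finset ℕ), A u = A s ∩ A t := by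
    ext ω
    simp
  simp only [Finset.prod_pair hst] at h1
  rw [hI, hAs, hAt] at h1
  have h2 := integral_condExp (μ := P) (f := (X σ ⁻¹' Set.Iic x ∩ X τ ⁻¹' Set.Iic y).indicator
    fun _ => (1 : ℝ)) h.latentSigma_le
  have h3 : ∫ ω, (Set.Iic x).indicator (fun _ => (1 : ℝ)) (X σ ω) *
      (Set.Iic y).indicator (fun _ => (1 : ℝ)) (X τ ω) ∂P
      = ∫ ω, (X σ ⁻¹' Set.Iic x ∩ X τ ⁻¹' Set.Iic y).indicator (fun _ => (1 : ℝ)) ω ∂P := by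
    refine integral_congr_ae (Eventually.of_forall fun ω => ?_)
    by_cases ha : X σ ω ≤ x <;> by_cases hb : X τ ω ≤ y <;> simp [Set.indicator, ha, hb]
  rw [h3, ← h2]
  refine integral_congr_ae ?_
  filter_upwards [h1, h.compatible s σ hσ _ (measurableSet_Iic (a := x)),
    h.compatible t τ hτ _ (measurableSet_Iic (a := y))] with ω e1 e2 e3
  rw [e1, e2, e3]
  rfl

theorem measurable_indicator_Iic (hX : ∀ τ, Measurable (X τ)) (τ : ℝ≥0) :
    Measurable fun w : Ω × ℝ => (Set.Iic w.2).indicator (fun _ => (1 : ℝ)) (X τ w.1) :=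
  Measurable.ite (measurableSet_le ((hX τ).comp measurable_fst) measurable_snd) measurable_const
    measurable_const

theorem measurable_empCdf (hX : ∀ τ, Measurable (X τ)) (S : SamplingScheme) (t : ℕ) :
    Measurable fun w : Ω × ℝ => empCdf X S t w.1 w.2 :=
  measurable_const.mul (Finset.measurable_sum _ fun _ _ => measurable_indicator_Iic hX _)

theorem measurable_empMean (hX : ∀ τ, Measurable (X τ)) (S : SamplingScheme) (n : ℕ) :
    Measurable fun w : Ω × ℝ => empMean X S n w.1 w.2 :=
  measurable_const.mul (Finset.measurable_sum _ fun _ _ => measurable_empCdf hX S _)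

theorem measurable_empAutocov (hX : ∀ τ, Measurable (X τ)) (S : SamplingScheme) (p n k : ℕ) :
    Measurable fun w : Ω × ℝ × ℝ => empAutocov X S p n k w.1 w.2.1 w.2.2 := by
  have h1 : ∀ G : Ω → ℝ → ℝ, (Measurable fun w : Ω × ℝ => G w.1 w.2) →
      Measurable fun w : Ω × ℝ × ℝ => G w.1 w.2.1 := fun G hG =>
    hG.comp (measurable_fst.prodMk (measurable_fst.comp measurable_snd))
  have h2 : ∀ G : Ω → ℝ → ℝ, (Measurable fun w : Ω × ℝ => G w.1 w.2) →
      Measurable fun w : Ω × ℝ × ℝ => G w.1 w.2.2 := fun G hG =>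
    hG.comp (measurable_fst.prodMk (measurable_snd.comp measurable_snd))
  have hE := fun t => measurable_empCdf hX S t
  have hM := measurable_empMean hX S n
  unfold empAutocov
  exact (Finset.measurable_sum (Finset.Icc 1 (n - p)) fun t _ =>
    ((h1 _ (hE t)).sub (h1 _ hM)).mul ((h2 _ (hE (t + k))).sub (h2 _ hM))).const_mul _

theorem integrable_of_abs_le_one {Z : Ω → ℝ} (hZ : Measurable Z) (h : ∀ ω, |Z ω| ≤ 1) :
    Integrable Z P :=
  memLp_one_iff_integrable.1 (memLp_of_abs_le hZ h 1)

theorem abs_indicator_Iic_le_one (x u : ℝ) :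
    |(Set.Iic x).indicator (fun _ => (1 : ℝ)) u| ≤ 1 := by
  by_cases h : u ∈ Set.Iic x <;> simp [h]

theorem IsConjugateProcess.integral_empCdf (h : IsConjugateProcess P ξ X)
    (hstat : IsStationary P ξ) (S : SamplingScheme) (t : ℕ) (x : ℝ) :
    ∫ ω, empCdf X S t ω x ∂P = meanCdf P ξ x := by
  have hm : ∀ i, Measurable fun ω =>
      (Set.Iic x).indicator (fun _ => (1 : ℝ)) (X (S.time t i) ω) := fun i =>
    (measurable_indicator_Iic h.measurable_observable _).comp measurable_prodMk_right
  have hq : (S.q t : ℝ) ≠ 0 := by exact_mod_cast (S.q_pos t).ne'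
  simp only [empCdf]
  rw [integral_const_mul, integral_finsetSum _ fun i _ =>
    integrable_of_abs_le_one (hm i) fun ω => abs_indicator_Iic_le_one _ _]
  rw [Finset.sum_congr rfl fun i hi => (h.integral_indicator
    (S.time_mem t i (Finset.mem_range.1 hi)) x).trans (hstat.integral_latentCdf t x)]
  rw [Finset.sum_const, Finset.card_range, nsmul_eq_mul, inv_mul_cancel_left₀ hq]

theorem IsConjugateProcess.integral_empCdf_mul (h : IsConjugateProcess P ξ X)
    (hstat : IsStationary P ξ) (hcyc : IsCyclicIndependent P ξ X) (S : SamplingScheme) (t : ℕ)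
    {k : ℕ} (hk : 1 ≤ k) (x y : ℝ) :
    ∫ ω, empCdf X S t ω x * empCdf X S (t + k) ω y ∂P
      = ∫ ω, latentCdf ξ 0 ω x * latentCdf ξ k ω y ∂P := by
  have hm : ∀ τ (x : ℝ), Measurable fun ω =>
      (Set.Iic x).indicator (fun _ => (1 : ℝ)) (X τ ω) := fun τ x =>
    (measurable_indicator_Iic h.measurable_observable τ).comp measurable_prodMk_right
  have hq : ∀ t, (S.q t : ℝ) ≠ 0 := fun t => by exact_mod_cast (S.q_pos t).ne'
  have hint : ∀ i j, Integrable (fun ω =>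
      (Set.Iic x).indicator (fun _ => (1 : ℝ)) (X (S.time t i) ω) *
        (Set.Iic y).indicator (fun _ => (1 : ℝ)) (X (S.time (t + k) j) ω)) P := fun i j =>
    integrable_of_abs_le_one ((hm _ x).mul (hm _ y)) fun ω => by
      rw [abs_mul]
      exact mul_le_one₀ (abs_indicator_Iic_le_one _ _) (abs_nonneg _)
        (abs_indicator_Iic_le_one _ _)
  simp only [empCdf, mul_mul_mul_comm, Finset.sum_mul_sum]
  rw [integral_const_mul, integral_finsetSum _ fun i _ => integrable_finsetSum _ fun j _ =>
    hint i j]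
  rw [Finset.sum_congr rfl fun i hi => (integral_finsetSum _ fun j _ => hint i j).trans
    (Finset.sum_congr rfl fun j hj => (h.integral_indicator_mul hcyc (by omega)
      (S.time_mem t i (Finset.mem_range.1 hi)) (S.time_mem (t + k) j (Finset.mem_range.1 hj))
      x y).trans (hstat.integral_latentCdf_mul t k x y))]
  simp only [Finset.sum_const, Finset.card_range, nsmul_eq_mul]
  field_simp [hq t, hq (t + k)]

theorem meanCdf_mem (x : ℝ) : meanCdf P ξ x ∈ Set.Icc (0 : ℝ) 1 := by
  refine ⟨integral_nonneg fun ω => (latentCdf_mem ξ 0 ω x).1, ?_⟩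
  have h := norm_integral_le_of_norm_le_const (μ := P) (f := fun ω => latentCdf ξ 0 ω x) (C := 1)
    (Eventually.of_forall fun ω => by
      rw [Real.norm_of_nonneg (latentCdf_mem ξ 0 ω x).1]
      exact (latentCdf_mem ξ 0 ω x).2)
  rw [probReal_univ, mul_one] at h
  exact (le_abs_self _).trans h

theorem measurable_latentCdf_section (hξ : ∀ t, Measurable (ξ t)) (t : ℕ) (x : ℝ) :
    Measurable fun ω => latentCdf ξ t ω x :=
  (measurable_latentCdf hξ t).comp measurable_prodMk_right

theorem IsStationary.autocov_eq (hstat : IsStationary P ξ) (hξ : ∀ t, Measurable (ξ t))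
    (k : ℕ) (x y : ℝ) :
    autocov P ξ k x y = ∫ ω, latentCdf ξ 0 ω x * latentCdf ξ k ω y ∂P
      - meanCdf P ξ x * meanCdf P ξ y := by
  rw [autocov, covariance_eq_sub
    (memLp_of_abs_le (measurable_latentCdf_section hξ 0 x) (abs_latentCdf_le_one ξ 0 · x) 2)
    (memLp_of_abs_le (measurable_latentCdf_section hξ k y) (abs_latentCdf_le_one ξ k · y) 2),
    hstat.integral_latentCdf k y]
  rfl

theorem abs_empCdf_sub_meanCdf (S : SamplingScheme) (t : ℕ) (ω : Ω) (x : ℝ) :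
    |empCdf X S t ω x - meanCdf P ξ x| ≤ 1 := by
  have h1 := empCdf_mem X S t ω x
  have h2 := meanCdf_mem (P := P) (ξ := ξ) x
  rw [abs_le]
  constructor <;> linarith [h1.1, h1.2, h2.1, h2.2]

theorem measurable_empCdf_section (hX : ∀ τ, Measurable (X τ)) (S : SamplingScheme) (t : ℕ)
    (x : ℝ) : Measurable fun ω => empCdf X S t ω x :=
  (measurable_empCdf hX S t).comp measurable_prodMk_right

theorem IsConjugateProcess.integral_centered_mul (h : IsConjugateProcess P ξ X)
    (hstat : IsStationary P ξ) (hcyc : IsCyclicIndependent P ξ X) (S : SamplingScheme) (t : ℕ)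
    {k : ℕ} (hk : 1 ≤ k) (x y : ℝ) :
    ∫ ω, (empCdf X S t ω x - meanCdf P ξ x) * (empCdf X S (t + k) ω y - meanCdf P ξ y) ∂P
      = autocov P ξ k x y := by
  have hX := h.measurable_observable
  have hab : ∀ t ω x, |empCdf X S t ω x| ≤ 1 := fun t ω x => by
    rw [abs_of_nonneg (empCdf_mem X S t ω x).1]
    exact (empCdf_mem X S t ω x).2
  have hL : ∀ t x, MemLp (fun ω => empCdf X S t ω x) 2 P := fun t x =>
    memLp_of_abs_le (measurable_empCdf_section hX S t x) (hab t · x) 2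
  have h1 := covariance_eq_sub (hL t x) (hL (t + k) y)
  rw [covariance, h.integral_empCdf hstat, h.integral_empCdf hstat] at h1
  rw [h1, hstat.autocov_eq h.measurable_latent]
  congr 1
  exact h.integral_empCdf_mul hstat hcyc S t hk x y

/-- Mean-square bounds of order `n` for sums of centred empirical distribution functions and of
their centred lagged products, uniformly in the arguments. -/
theorem IsConjugateProcess.exists_integral_sq_sum_le (h : IsConjugateProcess P ξ X)
    (hstat : IsStationary P ξ) (hcyc : IsCyclicIndependent P ξ X) (S : SamplingScheme)
    (hsum : ∑' k : ℕ, (k : ℝ≥0∞) * psiMixingCoeff P (fun t => empCdf X S (t + 1)) k ^ (1 / 2 : ℝ)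
      < ∞) :
    (∃ C, 0 ≤ C ∧ ∀ x (N : ℕ),
      ∫ ω, (∑ t ∈ Finset.Icc 1 N, (empCdf X S t ω x - meanCdf P ξ x)) ^ 2 ∂P ≤ C * N) ∧
    ∀ k, 1 ≤ k → ∃ C, 0 ≤ C ∧ ∀ x y (N : ℕ),
      ∫ ω, (∑ t ∈ Finset.Icc 1 N, ((empCdf X S t ω x - meanCdf P ξ x) *
        (empCdf X S (t + k) ω y - meanCdf P ξ y) - autocov P ξ k x y)) ^ 2 ∂P ≤ C * N := by
  have hX := h.measurable_observable
  have hY : ∀ t, Measurable (empCdf X S (t + 1)) := fun t =>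
    measurable_pi_iff.2 fun x => measurable_empCdf_section hX S (t + 1) x
  have hvar : ∀ (Z : ℕ → Ω → ℝ) (a : ℝ), (∀ t, Measurable (Z t)) → (∀ t ω, |Z t ω| ≤ 1) →
      (∀ t, ∫ ω, Z t ω ∂P = a) → ∀ N : ℕ,
      Var[fun ω => ∑ t ∈ Finset.range N, Z (t + 1) ω; P]
        = ∫ ω, (∑ t ∈ Finset.Icc 1 N, (Z t ω - a)) ^ 2 ∂P := by
    intro Z a hZ hZ1 hZa N
    have hmean : ∫ ω, ∑ t ∈ Finset.range N, Z (t + 1) ω ∂P = N * a := by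
      rw [integral_finsetSum _ fun t _ => integrable_of_abs_le_one (hZ _) (hZ1 _)]
      simp [hZa]
    rw [variance_eq_integral (Finset.measurable_sum _ fun t _ => hZ (t + 1)).aemeasurable, hmean]
    refine integral_congr_ae (Eventually.of_forall fun ω => ?_)
    simp only [sum_Icc_one_eq_sum_range, Finset.sum_sub_distrib, Finset.sum_const,
      Nat.card_Icc, nsmul_eq_mul, add_tsub_cancel_right]
  have hc := abs_empCdf_sub_meanCdf (P := P) (ξ := ξ) (X := X) S
  have hcm : ∀ t x, Measurable fun ω => empCdf X S t ω x - meanCdf P ξ x := fun t x =>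
    (measurable_empCdf_section hX S t x).sub_const _
  refine ⟨?_, fun k hk => ?_⟩
  · obtain ⟨C, hC, hC'⟩ := exists_variance_sum_le hY hsum 0
    refine ⟨C, hC, fun x N => ?_⟩
    have h1 := hC' (fun u _ => u x - meanCdf P ξ x)
      (((measurable_pi_apply x).comp measurable_fst).sub_const _) (fun t ω => hc (t + 1) ω x) N
    rw [hvar (fun t ω => empCdf X S t ω x - meanCdf P ξ x) 0 (hcm · x) (fun t ω => hc t ω x)
      fun t => ?_] at h1
    · simpa only [sub_zero] using h1
    · have hi : Integrable (fun ω => empCdf X S t ω x) P :=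
        integrable_of_abs_le_one (measurable_empCdf_section hX S t x) fun ω => by
          rw [abs_of_nonneg (empCdf_mem X S t ω x).1]
          exact (empCdf_mem X S t ω x).2
      rw [integral_sub hi (integrable_const _), h.integral_empCdf hstat, integral_const,
        probReal_univ, one_smul, sub_self]
  · obtain ⟨C, hC, hC'⟩ := exists_variance_sum_le hY hsum k
    refine ⟨C, hC, fun x y N => ?_⟩
    have hb : ∀ t ω, |(empCdf X S t ω x - meanCdf P ξ x) *
        (empCdf X S (t + k) ω y - meanCdf P ξ y)| ≤ 1 := fun t ω => by
      rw [abs_mul]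
      exact mul_le_one₀ (hc t ω x) (abs_nonneg _) (hc (t + k) ω y)
    have h1 := hC' (fun u v => (u x - meanCdf P ξ x) * (v y - meanCdf P ξ y))
      ((((measurable_pi_apply x).comp measurable_fst).sub_const _).mul
        (((measurable_pi_apply y).comp measurable_snd).sub_const _))
      (fun t ω => by simpa only [add_right_comm t k 1] using hb (t + 1) ω) N
    simp only [add_right_comm _ k 1] at h1
    rwa [hvar (fun t ω => (empCdf X S t ω x - meanCdf P ξ x) *
        (empCdf X S (t + k) ω y - meanCdf P ξ y)) (autocov P ξ k x y)
      (fun t => (hcm t x).mul (hcm (t + k) y)) hb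
      fun t => h.integral_centered_mul hstat hcyc S t hk x y] at h1

end Moments

section Kernels

theorem sq_integral_le {μ : Measure ℝ} [IsFiniteMeasure μ] {f : ℝ → ℝ} (hf : MemLp f 2 μ) :
    (∫ z, f z ∂μ) ^ 2 ≤ μ.real Set.univ * ∫ z, f z ^ 2 ∂μ := by
  set M := μ.real Set.univ
  set I := ∫ z, f z ∂μ with hI
  rcases (measureReal_nonneg (μ := μ) (s := Set.univ)).eq_or_lt with h0 | h0
  · have : μ = 0 := by
      rw [← Measure.measure_univ_eq_zero]
      exact (measureReal_eq_zero_iff).1 h0.symm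
    simp [I, this]
  have hi := hf.integrable (q := 2) one_le_two
  have h1 : 0 ≤ ∫ z, (M ^ 2 * f z ^ 2 - 2 * M * I * f z + I ^ 2) ∂μ :=
    integral_nonneg fun z => by
      have : M ^ 2 * f z ^ 2 - 2 * M * I * f z + I ^ 2 = (M * f z - I) ^ 2 := by ring
      rw [this]
      exact sq_nonneg _
  have hi' : Integrable (fun z => M ^ 2 * f z ^ 2 - 2 * M * I * f z) μ :=
    (hf.integrable_sq.const_mul _).sub (hi.const_mul _)
  rw [integral_add hi' (integrable_const _),
    integral_sub (hf.integrable_sq.const_mul _) (hi.const_mul _), integral_const_mul,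
    integral_const_mul, integral_const, smul_eq_mul, ← hI] at h1
  change 0 < M at h0
  change 0 ≤ M ^ 2 * _ - 2 * M * I * I + M * I ^ 2 at h1
  have h2 : 0 ≤ M * (M * ∫ z, f z ^ 2 ∂μ - I ^ 2) := by linarith
  have := nonneg_of_mul_nonneg_right h2 h0
  linarith

/-- The Hilbert–Schmidt distance of two kernels of the form `∑ₖ ∫ Cₖ(x,z) Cₖ(y,z) μ(dz)` is
controlled by the `L²` distances of the `Cₖ`. -/
theorem hsNorm_sub_sq_le {μ : Measure ℝ} [IsFiniteMeasure μ] (p : ℕ) {A B : ℕ → ℝ → ℝ → ℝ}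
    (hA : ∀ k, Measurable (Function.uncurry (A k))) (hB : ∀ k, Measurable (Function.uncurry (B k)))
    (hA1 : ∀ k x y, |A k x y| ≤ 1) (hB1 : ∀ k x y, |B k x y| ≤ 1) :
    (hsNorm μ fun x y => (∑ k ∈ Finset.Icc 1 p, ∫ z, A k x z * A k y z ∂μ)
        - ∑ k ∈ Finset.Icc 1 p, ∫ z, B k x z * B k y z ∂μ).toReal ^ 2
      ≤ 4 * p * μ.real Set.univ ^ 2 *
        ∑ k ∈ Finset.Icc 1 p, ∫ w, (A k w.1 w.2 - B k w.1 w.2) ^ 2 ∂(μ.prod μ) := by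
  set M := μ.real Set.univ with hM
  have hK : MemLp (Function.uncurry fun x y => (∑ k ∈ Finset.Icc 1 p, ∫ z, A k x z * A k y z ∂μ)
        - ∑ k ∈ Finset.Icc 1 p, ∫ z, B k x z * B k y z ∂μ) 2 (μ.prod μ) := (memLp_sum_integral_mul μ p A hA fun k => ⟨1, hA1 k⟩).sub
    (memLp_sum_integral_mul μ p B hB fun k => ⟨1, hB1 k⟩)
  rw [hsNorm_toReal_sq hK]
  have hsec : ∀ {C : ℝ → ℝ → ℝ}, Measurable (Function.uncurry C) → ∀ x, Measurable (C x) :=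
    fun hC x => hC.comp measurable_prodMk_left
  have hd2 : ∀ k x y, (A k x y - B k x y) ^ 2 ≤ 4 := fun k x y => by
    have h1 := abs_le.1 (hA1 k x y)
    have h2 := abs_le.1 (hB1 k x y)
    nlinarith
  have hdint : ∀ k, Integrable (fun w : ℝ × ℝ => (A k w.1 w.2 - B k w.1 w.2) ^ 2) (μ.prod μ) :=
    fun k => Integrable.of_bound (((hA k).sub (hB k)).pow_const 2).aestronglyMeasurable 4
      (Eventually.of_forall fun w => by
        rw [Real.norm_of_nonneg (sq_nonneg _)]
        exact hd2 k _ _)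
  have hsint : ∀ k x, Integrable (fun z => (A k x z - B k x z) ^ 2) μ := fun k x =>
    Integrable.of_bound ((((hsec (hA k) x)).sub (hsec (hB k) x)).pow_const 2).aestronglyMeasurable
      4 (Eventually.of_forall fun w => by
        rw [Real.norm_of_nonneg (sq_nonneg _)]
        exact hd2 k _ _)
  let g : ℕ → ℝ → ℝ := fun k x => ∫ z, (A k x z - B k x z) ^ 2 ∂μ
  have hgint : ∀ k, Integrable (g k) μ := fun k => (hdint k).integral_prod_left
  have hG : ∀ k, ∫ x, g k x ∂μ = ∫ w, (A k w.1 w.2 - B k w.1 w.2) ^ 2 ∂(μ.prod μ) := fun k =>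
    (integral_prod _ (hdint k)).symm
  have hpt : ∀ x y, ((∑ k ∈ Finset.Icc 1 p, ∫ z, A k x z * A k y z ∂μ)
        - ∑ k ∈ Finset.Icc 1 p, ∫ z, B k x z * B k y z ∂μ) ^ 2
      ≤ 2 * p * M * ∑ k ∈ Finset.Icc 1 p, (g k x + g k y) := fun x y => by
    have hL : ∀ {C : ℝ → ℝ → ℝ}, Measurable (Function.uncurry C) → (∀ x y, |C x y| ≤ 1) →
        MemLp (fun z => C x z * C y z) 2 μ := fun hC hC1 =>
      MemLp.of_bound ((hsec hC x).mul (hsec hC y)).aestronglyMeasurable 1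
        (Eventually.of_forall fun z => by
          rw [norm_mul]
          exact mul_le_one₀ (hC1 x z) (norm_nonneg _) (hC1 y z))
    have hone : ∀ k, (∫ z, A k x z * A k y z ∂μ - ∫ z, B k x z * B k y z ∂μ) ^ 2
        ≤ M * (2 * (g k x + g k y)) := fun k => by
      have h1 := hL (hA k) (hA1 k)
      have h2 := hL (hB k) (hB1 k)
      rw [← integral_sub (h1.integrable one_le_two) (h2.integrable one_le_two)]
      refine (sq_integral_le (h1.sub h2)).trans ?_
      refine mul_le_mul_of_nonneg_left ?_ measureReal_nonneg
      have h3 : 2 * (g k x + g k y)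
          = ∫ z, 2 * ((A k x z - B k x z) ^ 2 + (A k y z - B k y z) ^ 2) ∂μ := by
        rw [integral_const_mul, integral_add (hsint k x) (hsint k y)]
      rw [h3]
      refine integral_mono (h1.sub h2).integrable_sq
        (((hsint k x).add (hsint k y)).const_mul 2) fun z => ?_
      have e1 := abs_le.1 (hA1 k y z)
      have e2 := abs_le.1 (hB1 k x z)
      have e3 : A k y z ^ 2 ≤ 1 := by nlinarith
      have e4 : B k x z ^ 2 ≤ 1 := by nlinarith
      simp only [Pi.sub_apply]
      have e5 : A k x z * A k y z - B k x z * B k y z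
          = (A k x z - B k x z) * A k y z + B k x z * (A k y z - B k y z) := by ring
      rw [e5]
      have e6 := mul_le_mul_of_nonneg_left e3 (sq_nonneg (A k x z - B k x z))
      have e7 := mul_le_mul_of_nonneg_left e4 (sq_nonneg (A k y z - B k y z))
      nlinarith [sq_nonneg ((A k x z - B k x z) * A k y z - B k x z * (A k y z - B k y z))]
    rw [← Finset.sum_sub_distrib]
    refine (sq_sum_le_card_mul_sum_sq).trans ?_
    rw [Nat.card_Icc, add_tsub_cancel_right]
    refine (mul_le_mul_of_nonneg_left (Finset.sum_le_sum fun k _ => hone k)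
      (Nat.cast_nonneg p)).trans (le_of_eq ?_)
    simp only [Finset.mul_sum]
    exact Finset.sum_congr rfl fun k _ => by ring
  have hin : ∀ x, ∫ y, ((∑ k ∈ Finset.Icc 1 p, ∫ z, A k x z * A k y z ∂μ)
        - ∑ k ∈ Finset.Icc 1 p, ∫ z, B k x z * B k y z ∂μ) ^ 2 ∂μ
      ≤ 2 * p * M * ∑ k ∈ Finset.Icc 1 p, (M * g k x + ∫ y, g k y ∂μ) := fun x => by
    refine (integral_mono_of_nonneg (Eventually.of_forall fun y => sq_nonneg _)
      ((integrable_finsetSum _ fun k _ => (integrable_const (g k x)).add (hgint k)).const_mul _)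
      (Eventually.of_forall fun y => hpt x y)).trans (le_of_eq ?_)
    rw [integral_const_mul, integral_finsetSum _ fun k _ =>
      (integrable_const (g k x)).add (hgint k)]
    congr 1
    refine Finset.sum_congr rfl fun k _ => ?_
    rw [integral_add' (integrable_const _) (hgint k), integral_const, smul_eq_mul]
  refine (integral_mono_of_nonneg
    (Eventually.of_forall fun x => integral_nonneg fun y => sq_nonneg _)
    ((integrable_finsetSum _ fun k _ => ((hgint k).const_mul M).add
      (integrable_const (∫ y, g k y ∂μ))).const_mul _)
    (Eventually.of_forall hin)).trans (le_of_eq ?_)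
  rw [integral_const_mul, integral_finsetSum _ fun k _ => ((hgint k).const_mul M).add
      (integrable_const (∫ y, g k y ∂μ))]
  simp only [Finset.mul_sum]
  refine Finset.sum_congr rfl fun k _ => ?_
  rw [integral_add' ((hgint k).const_mul M) (integrable_const _), integral_const,
    integral_const_mul, smul_eq_mul, ← hM, hG]
  ring

end Kernels

section StochasticOrder

variable {Ω : Type*} [MeasurableSpace Ω] {P : Measure Ω}

/-- A sequence whose squares are dominated by variables with expectation of order `1 / n` is
`O_P(n ^ (-1 / 2))`. -/
theorem isBigOP_of_sq_le {Z : ℕ → Ω → ℝ≥0∞} {J : ℕ → Ω → ℝ} {C : ℝ} (hC : 0 ≤ C)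
    (h : ∀ᶠ n : ℕ in atTop, Integrable (J n) P ∧ ∫ ω, J n ω ∂P ≤ C / n ∧
      ∀ ω, Z n ω ≠ ∞ ∧ (Z n ω).toReal ^ 2 ≤ J n ω) :
    IsBigOP P Z (fun n => (n : ℝ) ^ (-(1 / 2) : ℝ)) := by
  intro ε hε
  obtain ⟨δ, hδ, hδε⟩ : ∃ δ : ℝ, 0 < δ ∧ ENNReal.ofReal δ ≤ ε := by
    rcases eq_or_ne ε ∞ with rfl | hε'
    · exact ⟨1, one_pos, le_top⟩
    · exact ⟨ε.toReal, ENNReal.toReal_pos hε.ne' hε', ENNReal.ofReal_toReal_le⟩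
  refine ⟨Real.toNNReal (√(C / δ) + 1), ?_⟩
  set M : ℝ := √(C / δ) + 1 with hM
  have hM0 : 0 < M := by positivity
  have hCM : C ≤ δ * M ^ 2 := by
    have h1 : √(C / δ) ^ 2 = C / δ := Real.sq_sqrt (by positivity)
    have h2 : C / δ ≤ M ^ 2 := by
      rw [← h1]
      exact pow_le_pow_left₀ (Real.sqrt_nonneg _) (by linarith) 2
    rw [div_le_iff₀ hδ] at h2
    linarith
  filter_upwards [h, eventually_gt_atTop 0] with n ⟨hJ, hJn, hZ⟩ hn
  have hn0 : (0 : ℝ) < n := by exact_mod_cast hn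
  have hsub : {ω | (Real.toNNReal M : ℝ≥0∞) * ENNReal.ofReal ((n : ℝ) ^ (-(1 / 2) : ℝ)) < Z n ω}
      ⊆ {ω | M ^ 2 / n ≤ J n ω} := by
    intro ω hω
    obtain ⟨hZt, hZJ⟩ := hZ ω
    refine le_trans ?_ hZJ
    have h1 : M * (n : ℝ) ^ (-(1 / 2) : ℝ) ≤ (Z n ω).toReal := by
      refine (ENNReal.ofReal_le_iff_le_toReal hZt).1 ?_
      rw [ENNReal.ofReal_mul hM0.le]
      exact le_of_lt hω
    refine le_trans (le_of_eq ?_) (pow_le_pow_left₀ (by positivity) h1 2)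
    rw [mul_pow, ← Real.rpow_natCast ((n : ℝ) ^ (-(1 / 2) : ℝ)), ← Real.rpow_mul hn0.le]
    norm_num [Real.rpow_neg_one, div_eq_mul_inv]
  have hJ0 : 0 ≤ᵐ[P] J n := Eventually.of_forall fun ω => (sq_nonneg _).trans (hZ ω).2
  have hmark := mul_meas_ge_le_lintegral₀ (μ := P)
    (f := fun ω => ENNReal.ofReal (J n ω)) hJ.aestronglyMeasurable.aemeasurable.ennreal_ofReal
    (ENNReal.ofReal (M ^ 2 / n))
  rw [← ofReal_integral_eq_lintegral_ofReal hJ hJ0] at hmark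
  have hpos : 0 < M ^ 2 / n := by positivity
  have hle : ENNReal.ofReal (M ^ 2 / n) * P {ω | M ^ 2 / n ≤ J n ω}
      ≤ ENNReal.ofReal (M ^ 2 / n) * ENNReal.ofReal δ := by
    refine le_trans (mul_le_mul_right (measure_mono fun ω hω => ENNReal.ofReal_le_ofReal hω) _)
      (hmark.trans ?_)
    rw [← ENNReal.ofReal_mul hpos.le]
    refine ENNReal.ofReal_le_ofReal (hJn.trans ?_)
    rw [div_mul_eq_mul_div]
    exact div_le_div_of_nonneg_right (by linarith) hn0.le
  rw [ENNReal.mul_le_mul_iff_right (by simpa using hpos) ENNReal.ofReal_ne_top] at hle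
  exact (measure_mono hsub).trans (hle.trans hδε)

theorem IsBigOP.of_le_const_mul {Z Z' : ℕ → Ω → ℝ≥0∞} {a : ℕ → ℝ} (h : IsBigOP P Z a) (c : ℝ≥0)
    (hle : ∀ n ω, Z' n ω ≤ c * Z n ω) : IsBigOP P Z' a := by
  intro ε hε
  obtain ⟨M, hM⟩ := h ε hε
  refine ⟨c * M, hM.mono fun n hn => (measure_mono fun ω hω => ?_).trans hn⟩
  rw [Set.mem_ofPred_eq] at hω ⊢
  by_contra! hcon
  refine (lt_of_lt_of_le hω (hle n ω)).not_ge ?_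
  rw [ENNReal.coe_mul, mul_assoc]
  exact mul_le_mul_right hcon _

end StochasticOrder

section Estimation

theorem abs_inv_mul_sum_le_one {N : ℕ} {f : ℕ → ℝ} (hf : ∀ t, |f t| ≤ 1) :
    |(N : ℝ)⁻¹ * ∑ t ∈ Finset.Icc 1 N, f t| ≤ 1 := by
  have h1 : |∑ t ∈ Finset.Icc 1 N, f t| ≤ N := by
    refine (Finset.abs_sum_le_sum_abs _ _).trans ((Finset.sum_le_sum fun t _ => hf t).trans ?_)
    simp
  rw [abs_mul, abs_of_nonneg (by positivity : (0 : ℝ) ≤ (N : ℝ)⁻¹)]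
  rcases (Nat.cast_nonneg (α := ℝ) N).eq_or_lt with h0 | h0
  · simp [← h0]
  · rwa [inv_mul_le_iff₀ h0, mul_one]

theorem sq_inv_mul_sum_mul_sub_le {N : ℕ} (hN : 0 < N) {u w : ℕ → ℝ} {a b c : ℝ}
    (hu : ∀ t, |u t| ≤ 1) (hw : ∀ t, |w t| ≤ 1) :
    ((N : ℝ)⁻¹ * ∑ t ∈ Finset.Icc 1 N, (u t - a) * w t - c) ^ 2
      ≤ 3 * (((N : ℝ)⁻¹ * ∑ t ∈ Finset.Icc 1 N, (u t * (w t + b) - c)) ^ 2 + a ^ 2 + b ^ 2) := by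
  have hN0 : (N : ℝ) ≠ 0 := by exact_mod_cast hN.ne'
  have h1 := abs_inv_mul_sum_le_one (N := N) hu
  have h2 := abs_inv_mul_sum_le_one (N := N) hw
  set U := (N : ℝ)⁻¹ * ∑ t ∈ Finset.Icc 1 N, u t with hU
  set W := (N : ℝ)⁻¹ * ∑ t ∈ Finset.Icc 1 N, w t with hW
  set V := (N : ℝ)⁻¹ * ∑ t ∈ Finset.Icc 1 N, (u t * (w t + b) - c) with hV
  have h3 : (N : ℝ)⁻¹ * ∑ t ∈ Finset.Icc 1 N, (u t - a) * w t - c = V - a * W - b * U := by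
    rw [hU, hW, hV]
    simp only [sub_mul, mul_add, Finset.sum_sub_distrib, Finset.sum_add_distrib,
      ← Finset.mul_sum, ← Finset.sum_mul, Finset.sum_const, Nat.card_Icc, add_tsub_cancel_right,
      nsmul_eq_mul]
    field_simp
    ring
  rw [h3]
  have hU2 : U ^ 2 ≤ 1 := (sq_le_one_iff_abs_le_one U).2 h1
  have hW2 : W ^ 2 ≤ 1 := (sq_le_one_iff_abs_le_one W).2 h2
  have h4 := mul_le_mul_of_nonneg_left hU2 (sq_nonneg b)
  have h5 := mul_le_mul_of_nonneg_left hW2 (sq_nonneg a)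
  nlinarith [sq_nonneg (V + a * W), sq_nonneg (V + b * U), sq_nonneg (a * W - b * U)]

variable {Ω : Type*} [mΩ : MeasurableSpace Ω] {P : Measure Ω} [IsProbabilityMeasure P]
  {ξ : ℕ → Ω → ProbabilityMeasure ℝ} {X : ℝ≥0 → Ω → ℝ}

theorem abs_empCdf_sub_empMean {Ω : Type*} (X : ℝ≥0 → Ω → ℝ) (S : SamplingScheme) (n t : ℕ)
    (ω : Ω) (x : ℝ) : |empCdf X S t ω x - empMean X S n ω x| ≤ 1 := by
  have h1 := fun t => empCdf_mem X S t ω x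
  have h2 : |empMean X S n ω x| ≤ 1 := abs_inv_mul_sum_le_one fun t => by
    rw [abs_of_nonneg (h1 t).1]
    exact (h1 t).2
  have h3 : 0 ≤ empMean X S n ω x :=
    mul_nonneg (by positivity) (Finset.sum_nonneg fun t _ => (h1 t).1)
  have h4 := abs_le.1 h2
  rw [abs_le]
  constructor <;> linarith [(h1 t).1, (h1 t).2, h4.2]

theorem abs_empAutocov_le_one {Ω : Type*} (X : ℝ≥0 → Ω → ℝ) (S : SamplingScheme) {p n : ℕ}
    (hn : p ≤ n) (k : ℕ) (ω : Ω) (x y : ℝ) : |empAutocov X S p n k ω x y| ≤ 1 := by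
  rw [empAutocov, ← Nat.cast_sub hn]
  refine abs_inv_mul_sum_le_one fun t => ?_
  rw [abs_mul]
  exact mul_le_one₀ (abs_empCdf_sub_empMean X S n t ω x) (abs_nonneg _)
    (abs_empCdf_sub_empMean X S n (t + k) ω y)

theorem abs_autocov_le_one (ξ : ℕ → Ω → ProbabilityMeasure ℝ) (k : ℕ) (x y : ℝ) :
    |autocov P ξ k x y| ≤ 1 := by
  have h := norm_integral_le_of_norm_le_const (μ := P) (C := 1)
    (f := fun ω => (latentCdf ξ 0 ω x - ∫ ω', latentCdf ξ 0 ω' x ∂P) *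
      (latentCdf ξ k ω y - ∫ ω', latentCdf ξ k ω' y ∂P)) (Eventually.of_forall fun ω => by
    rw [norm_mul]
    exact mul_le_one₀ (abs_sub_integral_latentCdf P ξ 0 ω x) (norm_nonneg _)
      (abs_sub_integral_latentCdf P ξ k ω y))
  rwa [probReal_univ, mul_one] at h

theorem measurable_autocov (hξ : ∀ t, Measurable (ξ t)) (k : ℕ) :
    Measurable (Function.uncurry (autocov P ξ k)) := by
  have hF : ∀ t, Measurable fun v : ℝ × Ω => latentCdf ξ t v.2 v.1 := fun t =>
    (measurable_latentCdf hξ t).comp measurable_swap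
  have hm : ∀ t, Measurable fun x : ℝ => ∫ ω, latentCdf ξ t ω x ∂P := fun t =>
    ((hF t).stronglyMeasurable.integral_prod_right' (ν := P)).measurable
  have hd : ∀ t, Measurable fun v : ℝ × Ω => latentCdf ξ t v.2 v.1 -
      ∫ ω, latentCdf ξ t ω v.1 ∂P := fun t => (hF t).sub ((hm t).comp measurable_fst)
  have h : Measurable fun v : (ℝ × ℝ) × Ω =>
      (latentCdf ξ 0 v.2 v.1.1 - ∫ ω, latentCdf ξ 0 ω v.1.1 ∂P) *
        (latentCdf ξ k v.2 v.1.2 - ∫ ω, latentCdf ξ k ω v.1.2 ∂P) :=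
    ((hd 0).comp ((measurable_fst.comp measurable_fst).prodMk measurable_snd)).mul
      ((hd k).comp ((measurable_snd.comp measurable_fst).prodMk measurable_snd))
  exact (h.stronglyMeasurable.integral_prod_right' (ν := P)).measurable

/-- The mean-square error of the estimated autocovariances is of order `1 / n`, uniformly in the
arguments. -/
theorem IsConjugateProcess.exists_integral_sq_empAutocov_sub_le (h : IsConjugateProcess P ξ X)
    (hstat : IsStationary P ξ) (hcyc : IsCyclicIndependent P ξ X) (S : SamplingScheme)
    (hsum : ∑' k : ℕ, (k : ℝ≥0∞) * psiMixingCoeff P (fun t => empCdf X S (t + 1)) k ^ (1 / 2 : ℝ)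
      < ∞) (p : ℕ) {k : ℕ} (hk : 1 ≤ k) :
    ∃ D, 0 ≤ D ∧ ∀ n : ℕ, 2 * p < n → ∀ x y,
      ∫ ω, (empAutocov X S p n k ω x y - autocov P ξ k x y) ^ 2 ∂P ≤ D / n := by
  obtain ⟨⟨C0, hC0, h0⟩, hall⟩ := h.exists_integral_sq_sum_le hstat hcyc S hsum
  obtain ⟨C1, hC1, h1⟩ := hall k hk
  refine ⟨3 * (2 * C1 + C0 + C0), by positivity, fun n hn x y => ?_⟩
  have hX := h.measurable_observable
  have hN : 0 < n - p := by omega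
  have hn0 : (0 : ℝ) < n := by exact_mod_cast (by omega : 0 < n)
  let u : ℕ → Ω → ℝ → ℝ := fun t ω x => empCdf X S t ω x - meanCdf P ξ x
  have hum : ∀ t x, Measurable fun ω => u t ω x := fun t x =>
    (measurable_empCdf_section hX S t x).sub_const _
  have hu1 : ∀ t ω x, |u t ω x| ≤ 1 := fun t ω x => abs_empCdf_sub_meanCdf S t ω x
  let V : Ω → ℝ := fun ω => ∑ t ∈ Finset.Icc 1 (n - p),
    (u t ω x * u (t + k) ω y - autocov P ξ k x y)
  let A : ℝ → Ω → ℝ := fun x ω => ∑ t ∈ Finset.Icc 1 n, u t ω x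
  have hmean : ∀ ω x, empMean X S n ω x - meanCdf P ξ x = (n : ℝ)⁻¹ * A x ω := fun ω x => by
    simp only [A, u, empMean, Finset.sum_sub_distrib, Finset.sum_const, Nat.card_Icc,
      add_tsub_cancel_right, nsmul_eq_mul]
    field_simp
  have hpt : ∀ ω, (empAutocov X S p n k ω x y - autocov P ξ k x y) ^ 2
      ≤ 3 * ((((n - p : ℕ) : ℝ)⁻¹ * V ω) ^ 2 + ((n : ℝ)⁻¹ * A x ω) ^ 2
        + ((n : ℝ)⁻¹ * A y ω) ^ 2) := fun ω => by
    have h2 := sq_inv_mul_sum_mul_sub_le hN (u := fun t => u t ω x)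
      (w := fun t => empCdf X S (t + k) ω y - empMean X S n ω y)
      (a := (n : ℝ)⁻¹ * A x ω) (b := (n : ℝ)⁻¹ * A y ω) (c := autocov P ξ k x y)
      (hu1 · ω x) (fun t => abs_empCdf_sub_empMean X S n (t + k) ω y)
    rw [← hmean, ← hmean] at h2
    rw [← hmean, ← hmean, empAutocov, ← Nat.cast_sub (by omega : p ≤ n)]
    simpa only [u, V, sub_sub_sub_cancel_right, sub_add_sub_cancel] using h2
  have hVL : MemLp V 2 P := memLp_finsetSum _ fun t _ =>
    (memLp_of_abs_le ((hum t x).mul (hum (t + k) y)) (fun ω => by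
      rw [Pi.mul_apply, abs_mul]
      exact mul_le_one₀ (hu1 t ω x) (abs_nonneg _) (hu1 (t + k) ω y)) 2).sub (memLp_const _)
  have hAL : ∀ x, MemLp (A x) 2 P := fun x => memLp_finsetSum _ fun t _ =>
    memLp_of_abs_le (hum t x) (hu1 t · x) 2
  have hV2 := (hVL.integrable_sq).const_mul ((((n - p : ℕ) : ℝ)⁻¹) ^ 2)
  have hA2 := fun x => ((hAL x).integrable_sq).const_mul (((n : ℝ)⁻¹) ^ 2)
  simp only [mul_pow] at hpt
  refine (integral_mono_of_nonneg (Eventually.of_forall fun ω => sq_nonneg _)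
    (((hV2.add (hA2 x)).add (hA2 y)).const_mul 3) (Eventually.of_forall hpt)).trans ?_
  rw [integral_const_mul, integral_add' (hV2.add (hA2 x)) (hA2 y), integral_add' hV2 (hA2 x),
    integral_const_mul, integral_const_mul, integral_const_mul, mul_div_assoc]
  refine mul_le_mul_of_nonneg_left ?_ (by norm_num)
  rw [add_div, add_div]
  have hinv : ∀ (N : ℕ) (C I : ℝ), 0 < N → I ≤ C * N → ((N : ℝ)⁻¹) ^ 2 * I ≤ C / N :=
    fun N C I hN hI => by
      have hN' : (0 : ℝ) < N := by exact_mod_cast hN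
      refine (mul_le_mul_of_nonneg_left hI (by positivity)).trans (le_of_eq ?_)
      field_simp
  refine add_le_add (add_le_add ((hinv _ C1 _ hN (h1 x y _)).trans ?_)
    (hinv _ C0 _ (by omega) (h0 x n))) (hinv _ C0 _ (by omega) (h0 y n))
  have hN' : (0 : ℝ) < (n - p : ℕ) := by exact_mod_cast hN
  rw [div_le_div_iff₀ hN' hn0]
  have h3 : (n : ℝ) ≤ 2 * (n - p : ℕ) := by exact_mod_cast (by omega : n ≤ 2 * (n - p))
  nlinarith

/-- The estimator of the kernel is `√n`-consistent in the Hilbert–Schmidt norm. -/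
theorem IsConjugateProcess.isBigOP_hsNorm (h : IsConjugateProcess P ξ X)
    (hstat : IsStationary P ξ) (hcyc : IsCyclicIndependent P ξ X) (S : SamplingScheme)
    (hsum : ∑' k : ℕ, (k : ℝ≥0∞) * psiMixingCoeff P (fun t => empCdf X S (t + 1)) k ^ (1 / 2 : ℝ)
      < ∞) (μ : Measure ℝ) [IsFiniteMeasure μ] (p : ℕ) :
    IsBigOP P (fun n ω => hsNorm μ fun x y => empKernelR X S μ p n ω x y - kernelR P ξ μ p x y)
      (fun n => (n : ℝ) ^ (-(1 / 2) : ℝ)) := by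
  have hX := h.measurable_observable
  have hD : ∀ k : ℕ, ∃ D, 0 ≤ D ∧ (1 ≤ k → ∀ n : ℕ, 2 * p < n → ∀ x y,
      ∫ ω, (empAutocov X S p n k ω x y - autocov P ξ k x y) ^ 2 ∂P ≤ D / n) := fun k => by
    by_cases hk : 1 ≤ k
    · obtain ⟨D, hD, hD'⟩ := h.exists_integral_sq_empAutocov_sub_le hstat hcyc S hsum p hk
      exact ⟨D, hD, fun _ => hD'⟩
    · exact ⟨0, le_rfl, fun hk' => absurd hk' hk⟩
  choose D hD0 hD using hD
  set M := μ.real Set.univ with hM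
  have hMp : (μ.prod μ).real Set.univ = M * M := by
    rw [← Set.univ_prod_univ, measureReal_prod_prod]
  let J : ℕ → Ω → ℝ := fun n ω => 4 * p * M ^ 2 * ∑ k ∈ Finset.Icc 1 p,
    ∫ w, (empAutocov X S p n k ω w.1 w.2 - autocov P ξ k w.1 w.2) ^ 2 ∂(μ.prod μ)
  refine isBigOP_of_sq_le (J := J)
    (C := 4 * p * M ^ 2 * ∑ k ∈ Finset.Icc 1 p, M * M * D k) ?_ ?_
  · exact mul_nonneg (by positivity)
      (Finset.sum_nonneg fun k _ => mul_nonneg (mul_self_nonneg M) (hD0 k))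
  filter_upwards [eventually_gt_atTop (2 * p)] with n hn
  have hpn : p ≤ n := by omega
  have hC1 := fun k x y => abs_autocov_le_one (P := P) ξ k x y
  have hCm := fun k => measurable_autocov (P := P) h.measurable_latent k
  have hint : ∀ k, Integrable (Function.uncurry fun (ω : Ω) (w : ℝ × ℝ) =>
      (empAutocov X S p n k ω w.1 w.2 - autocov P ξ k w.1 w.2) ^ 2) (P.prod (μ.prod μ)) := by
    intro k
    have hm : Measurable fun v : Ω × ℝ × ℝ =>
        (empAutocov X S p n k v.1 v.2.1 v.2.2 - autocov P ξ k v.2.1 v.2.2) ^ 2 :=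
      ((measurable_empAutocov hX S p n k).sub ((hCm k).comp measurable_snd)).pow_const 2
    refine Integrable.of_bound hm.aestronglyMeasurable 4 (Eventually.of_forall fun v => ?_)
    have h1 := abs_le.1 (abs_empAutocov_le_one X S hpn k v.1 v.2.1 v.2.2)
    have h2 := abs_le.1 (hC1 k v.2.1 v.2.2)
    simp only [Function.uncurry]
    rw [Real.norm_of_nonneg (sq_nonneg _)]
    nlinarith
  have hint' : ∀ k, Integrable (fun ω => ∫ w, (empAutocov X S p n k ω w.1 w.2 -
      autocov P ξ k w.1 w.2) ^ 2 ∂(μ.prod μ)) P := fun k => (hint k).integral_prod_left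
  refine ⟨(integrable_finsetSum _ fun k _ => hint' k).const_mul _, ?_, fun ω => ⟨?_, ?_⟩⟩
  · simp only [J]
    rw [integral_const_mul, integral_finsetSum _ fun k _ => hint' k,
      mul_div_assoc, Finset.sum_div]
    refine mul_le_mul_of_nonneg_left (Finset.sum_le_sum fun k hk => ?_) (by positivity)
    rw [integral_integral_swap (hint k)]
    refine (integral_mono (hint k).integral_prod_right (integrable_const (D k / n)) fun w =>
      hD k (Finset.mem_Icc.1 hk).1 n hn w.1 w.2).trans (le_of_eq ?_)
    rw [integral_const, hMp, smul_eq_mul, mul_div_assoc]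
  · exact ((memLp_empKernelR X S μ p n ω).sub (memLp_kernelR P h.measurable_latent μ p)).2.ne
  · refine hsNorm_sub_sq_le p (fun k => ?_) hCm
      (fun k x y => abs_empAutocov_le_one X S hpn k ω x y) hC1
    have hsec : ∀ G : Ω → ℝ → ℝ → ℝ, (Measurable fun w : Ω × ℝ × ℝ => G w.1 w.2.1 w.2.2) →
        Measurable (Function.uncurry (G ω)) := fun G hG => hG.comp measurable_prodMk_left
    exact hsec _ (measurable_empAutocov hX S p n k)

end Estimation

section Operators

variable {Ω : Type*} [MeasurableSpace Ω]

theorem kernelR_symm (P : Measure Ω) (ξ : ℕ → Ω → ProbabilityMeasure ℝ) (μ : Measure ℝ) (p : ℕ)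
    (x y : ℝ) : kernelR P ξ μ p x y = kernelR P ξ μ p y x := by
  simp only [kernelR, mul_comm]

theorem empKernelR_symm {Ω : Type*} (X : ℝ≥0 → Ω → ℝ) (S : SamplingScheme) (μ : Measure ℝ)
    (p n : ℕ) (ω : Ω) (x y : ℝ) : empKernelR X S μ p n ω x y = empKernelR X S μ p n ω y x := by
  simp only [empKernelR, mul_comm]

end Operators

end ConjugateProcess

open ConjugateProcess in
theorem mainTheorem6 {Ω : Type*} [MeasurableSpace Ω] (P : Measure Ω) [IsProbabilityMeasure P]
    (ξ : ℕ → Ω → ProbabilityMeasure ℝ) (X : ℝ≥0 → Ω → ℝ)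
    (hstat : IsStationary P ξ) (hconj : IsConjugateProcess P ξ X)
    (hcyc : IsCyclicIndependent P ξ X)
    (μ : Measure ℝ) [IsFiniteMeasure μ] (hμ : IsDiffraction P ξ μ)
    (S : SamplingScheme) (p : ℕ) (hp : 1 ≤ p)
    (hmix : Tendsto (psiMixingCoeff P fun t => empCdf X S (t + 1)) atTop (𝓝 0))
    (hsum : ∑' k : ℕ, (k : ℝ≥0∞) * psiMixingCoeff P (fun t => empCdf X S (t + 1)) k ^ (1 / 2 : ℝ)
      < ∞) :
    IsBigOP P (fun n ω => hsNorm μ fun x y => empKernelR X S μ p n ω x y - kernelR P ξ μ p x y)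
      (fun n => (n : ℝ) ^ (-(1 / 2) : ℝ)) ∧
    ∀ (θ : ℕ → ℝ) (θhat : ℕ → Ω → ℕ → ℝ), IsEigenvalueSeq (opR P ξ μ p) θ →
      (∀ n ω, IsEigenvalueSeq (empOpR X S μ p n ω) (θhat n ω)) →
      IsBigOP P (fun n ω => ⨆ j, ENNReal.ofReal |θhat n ω j - θ j|)
        (fun n => (n : ℝ) ^ (-(1 / 2) : ℝ)) ∧
      ((∀ i j, i ≠ j → θ i ≠ 0 → θ i ≠ θ j) →
        ∀ (ψ : ℕ → Lp ℝ 2 μ) (ψhat : ℕ → Ω → ℕ → Lp ℝ 2 μ),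
          IsEigenbasisSeq (opR P ξ μ p) θ ψ →
          (∀ n ω, IsEigenbasisSeq (empOpR X S μ p n ω) (θhat n ω) (ψhat n ω)) →
          ∀ j, 0 < θ j → (∀ n ω, 0 ≤ inner ℝ (ψhat n ω j) (ψ j)) →
            IsBigOP P (fun n ω => ‖ψhat n ω j - ψ j‖ₑ) (fun n => (n : ℝ) ^ (-(1 / 2) : ℝ))) := by
  have hHS := hconj.isBigOP_hsNorm hstat hcyc S hsum μ p
  refine ⟨hHS, fun θ θhat hθ hθhat => ?_⟩
  have hK := memLp_kernelR P hconj.measurable_latent μ p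
  have hK' := fun n ω => memLp_empKernelR X S μ p n ω
  have hfin : ∀ n ω, hsNorm μ (fun x y => empKernelR X S μ p n ω x y - kernelR P ξ μ p x y) ≠ ∞ :=
    fun n ω => ((hK' n ω).sub hK).2.ne
  have hs := isSymmetric_integralOperator hK (kernelR_symm P ξ μ p)
  have hs' := fun n ω => isSymmetric_integralOperator (hK' n ω) (empKernelR_symm X S μ p n ω)
  have hc := isCompactOperator_integralCLM hK
  have hc' := fun n ω => isCompactOperator_integralCLM (hK' n ω)
  have hdiff : ∀ n ω f, ‖integralCLM (hK' n ω) f - integralCLM hK f‖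
      ≤ (hsNorm μ fun x y => empKernelR X S μ p n ω x y - kernelR P ξ μ p x y).toReal * ‖f‖ :=
    fun n ω f => norm_integralOperator_sub_le (hK' n ω) hK f
  have hval : ∀ n ω j, |θhat n ω j - θ j|
      ≤ (hsNorm μ fun x y => empKernelR X S μ p n ω x y - kernelR P ξ μ p x y).toReal :=
    fun n ω j => (hθhat n ω).abs_sub_le (T := integralCLM (hK' n ω)) (T' := integralCLM hK)
      (hc' n ω) (hs' n ω) hc hs hθ ENNReal.toReal_nonneg (hdiff n ω) j
  refine ⟨hHS.of_le_const_mul 1 fun n ω => ?_, fun hsimple ψ ψhat hψ hψhat j hj hsign => ?_⟩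
  · rw [ENNReal.coe_one, one_mul]
    exact iSup_le fun j => ENNReal.ofReal_le_of_le_toReal (hval n ω j)
  · obtain ⟨K, hKb⟩ := hθ.exists_norm_le (T := integralCLM hK) hc hs hj
      (fun i hij hi => hsimple j i hij.symm hj.ne' hi.symm) (hψ.orthonormal.1 j) (hψ.apply_eq j)
    refine hHS.of_le_const_mul (4 * K) fun n ω => ?_
    have h1 := norm_eigenvector_sub_le (T := integralCLM hK) (T' := integralCLM (hK' n ω))
      K.2 (hψ.orthonormal.1 j) ((hψhat n ω).orthonormal.1 j) (hψ.apply_eq j)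
      ((hψhat n ω).apply_eq j) hKb (fun f => by rw [norm_sub_rev]; exact hdiff n ω f)
      (by rw [abs_sub_comm]; exact hval n ω j) (hsign n ω)
    rw [← ofReal_norm]
    refine (ENNReal.ofReal_le_ofReal h1).trans (le_of_eq ?_)
    rw [ENNReal.ofReal_mul (mul_nonneg (by norm_num) K.2), ENNReal.ofReal_toReal (hfin n ω)]
    congr 1
    rw [ENNReal.ofReal]
    congr 1
    ext
    simp
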